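/- Theorem 1.3. Let $A$ and $B$ be (complex, not necessarily unital) AF C*-algebras given by direct systems $A=\varinjlim (A_k,\phi_k)$ and $B=\varinjlim (B_k,\psi_k)$, indexed by $k\in\mathbb N$, of finite-dimensional C*-algebras (finite direct sums of full matrix algebras $M_n(\mathbb C)$, $n\ge 1$) with injective, not necessarily unital, $*$-homomorphisms $\phi_k : A_k\to A_{k+1}$ and $\psi_k : B_k\to B_{k+1}$. The Bratteli diagram of such a system has as vertices on level $k$ the matrix summands of the $k$-th algebra, and the number of edges from a summand on level $k$ to a summand on level $k+1$ is the multiplicity of the corresponding partial embedding. Say that a Bratteli diagram has the Fermion property if there are vertices $v_1,v_2,\dots$ on strictly increasing levels $n_1<n_2<\cdots$ such that for every $i$ there is more than one downward path (edges counted with multiplicity) from $v_i$ to $v_{i+1}$. If the Bratteli diagrams of both systems have the Fermion property, then $A$ and $B$ are isomorphic as topological vector spaces: there is a complex-linear homeomorphism of $A$ onto $B$. -/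

import Mathlib

/-- A Bratteli diagram: finitely many vertices on each level `k`, a label `size k i` (the size of the
matrix summand) on each vertex, and `mult k i j` edges from the vertex `i` on level `k` to the
vertex `j` on level `k + 1`. -/
structure BratteliDiagram where
  /-- the number of vertices on level `k` -/
  width : ℕ → ℕ
  /-- the label of a vertex -/
  size : ∀ k, Fin (width k) → ℕ
  /-- the number of edges between vertices on consecutive levels -/
  mult : ∀ k, Fin (width k) → Fin (width (k + 1)) → ℕ

namespace BratteliDiagram

/-- The vertices of the diagram, each with its level. -/
abbrev Vertex (D : BratteliDiagram) : Type := Σ k, Fin (D.width k)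

/-- The number of downward paths (edges counted with multiplicity) from the vertex `v` to the vertex
`w` on level `m`: the empty path if the two vertices coincide, and otherwise a path to some vertex
`u` on level `m - 1` followed by an edge from `u` to `w`. -/
def numPaths (D : BratteliDiagram) (v : D.Vertex) : (m : ℕ) → Fin (D.width m) → ℕ
  | 0, w => if v = ⟨0, w⟩ then 1 else 0
  | m + 1, w => (if v = ⟨m + 1, w⟩ then 1 else 0) +
      ∑ u : Fin (D.width m), numPaths D v m u * D.mult m u w

/-- The Fermion property: there are vertices `v 0, v 1, …` on strictly increasing levels with more
than one downward path from each of them to the next one. -/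
def FermionProperty (D : BratteliDiagram) : Prop :=
  ∃ v : ℕ → D.Vertex, StrictMono (fun t => (v t).1) ∧
    ∀ t, 1 < D.numPaths (v t) (v (t + 1)).1 (v (t + 1)).2

end BratteliDiagram

/-- A direct system `A₀ → A₁ → A₂ → …` of finite-dimensional C⋆-algebras, each of them written as a
finite direct sum of full complex matrix algebras, and injective (equivalently, isometric), not
necessarily unital, ⋆-homomorphisms. -/
structure AFSystem where
  /-- the number of matrix summands of `A_k` -/
  width : ℕ → ℕ
  /-- the sizes of the matrix summands of `A_k` -/
  size : ∀ k, Fin (width k) → ℕ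
  size_pos : ∀ k i, 0 < size k i
  /-- the connecting maps `A_k → A_{k+1}` -/
  map : ∀ k, (∀ i : Fin (width k), Matrix (Fin (size k i)) (Fin (size k i)) ℂ) →⋆ₙₐ[ℂ]
    (∀ j : Fin (width (k + 1)), Matrix (Fin (size (k + 1) j)) (Fin (size (k + 1) j)) ℂ)
  map_injective : ∀ k, Function.Injective (map k)

namespace AFSystem

/-- The finite-dimensional C⋆-algebra `A_k` of the system. -/
abbrev Alg (S : AFSystem) (k : ℕ) : Type :=
  ∀ i : Fin (S.width k), Matrix (Fin (S.size k i)) (Fin (S.size k i)) ℂ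

/-- A minimal projection of the `i`-th matrix summand of `A_k`: the upper left diagonal matrix unit,
regarded as an element of `A_k`. -/
def minProj (S : AFSystem) (k : ℕ) (i : Fin (S.width k)) : S.Alg k :=
  Pi.single i (Matrix.single ⟨0, S.size_pos k i⟩ ⟨0, S.size_pos k i⟩ 1)

/-- The multiplicity of the partial embedding of the `i`-th summand of `A_k` into the `j`-th summand
of `A_{k+1}`: the rank, in the `j`-th summand, of the image of a minimal projection of the `i`-th
summand. -/
noncomputable def mult (S : AFSystem) (k : ℕ) (i : Fin (S.width k)) (j : Fin (S.width (k + 1))) : ℕ :=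
  (S.map k (S.minProj k i) j).rank

/-- The Bratteli diagram of a direct system: the vertices on level `k` are the summands of `A_k`,
and the numbers of edges are the multiplicities of the partial embeddings. -/
noncomputable def bratteli (S : AFSystem) : BratteliDiagram where
  width := S.width
  size := S.size
  mult := S.mult

/-- `A` is the C⋆-algebra direct limit of the system: `A` contains compatible ⋆-isomorphic copies
of the algebras `A_k`, and is the closure of their increasing union. -/
def IsDirectLimit (S : AFSystem) (A : Type*) [NonUnitalCStarAlgebra A] : Prop :=
  ∃ ι : ∀ k, S.Alg k →⋆ₙₐ[ℂ] A,
    (∀ k, Function.Injective (ι k)) ∧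
    (∀ k x, ι (k + 1) (S.map k x) = ι k x) ∧
    Dense (⋃ k, Set.range (ι k))

end AFSystem

/-!
The proof is Pełczyński's decomposition method. Say that `X` is complemented in `Y` if the identity of
`X` factors through `Y` by bounded linear maps. The key fact is that for every AF algebra `A` and every
AF algebra `B` with the Fermion property the space `C₀(ℕ, A) × ℂ` is complemented in `B`
(`AFSystem.isComplementedIn_zeroAtInfty`). Hence, if both have the Fermion property, `A` and `B` are
complemented in each other, and `C₀(ℕ, A)` is complemented in `A`; as `C₀(ℕ, A) ≃ A × C₀(ℕ, A)`, this
gives `A ≃ A × A`, likewise `B ≃ B × B`, and then `A ≃ B × A ≃ A × B ≃ B`.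

The space `C₀(ℕ, A) × ℂ` is the unitization of `C₀(ℕ, A)`, thus the limit of a unital system of
finite-dimensional algebras `V k` with `V 0 = ℂ`. A unital ⋆-homomorphism between such algebras is block
diagonal in a suitable basis (`exists_intertwiners`, `exists_presentation`). On the other side, `N`
downward paths between two vertices of the diagram of `B` provide `N` isometries with orthogonal ranges
which intertwine the representations on the two summands (`AFSystem.hasIntertwiners_pathCount`), and by the
Fermion property their number is as large as desired on suitable levels. This is enough room to place
`V k` as a block diagonal corner of a matrix summand of some `B_{l k}`, each corner lying inside the
image of the preceding one, such that the compressions `B_{l k} → V k` are compatible with the connecting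
maps of both systems (`exists_corner_system`). In the limit they give a bounded map from `B` to
`C₀(ℕ, A) × ℂ`. The inclusions of the corners are
compatible only up to elements orthogonal to the next corner; the defect is removed with the help of
contractive left inverses of the connecting maps (`exists_compatible_lifting`), and the corrected maps
define a right inverse of the compression map.
-/

open Matrix
open scoped Matrix.Norms.L2Operator ZeroAtInfty

/-! ### Structure of ⋆-homomorphisms into matrix algebras -/

/-- A family of isometries `ℂ^{n c} → ℂ^m` (written as matrices) with mutually orthogonal ranges. -/
def IsOrthoIsometries {K : Type*} {m : ℕ} {n : K → ℕ}
    (W : ∀ c, Matrix (Fin m) (Fin (n c)) ℂ) : Prop :=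
  (∀ c, (W c)ᴴ * W c = 1) ∧ ∀ c d, c ≠ d → (W c)ᴴ * W d = 0

/-- A projection `P` is the range projection of an isometry defined on a space of dimension `P.rank`:
the columns of `X` are the eigenvectors of `P` with nonzero eigenvalue. -/
theorem exists_isometry_of_projection {m : ℕ} (P : Matrix (Fin m) (Fin m) ℂ)
    (hP : P.IsHermitian) (hPP : P * P = P) :
    ∃ X : Matrix (Fin m) (Fin P.rank) ℂ, Xᴴ * X = 1 ∧ X * Xᴴ = P := by
  classical
  set U : Matrix (Fin m) (Fin m) ℂ := hP.eigenvectorUnitary.1 with hU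
  have hUU : Uᴴ * U = 1 := Unitary.coe_star_mul_self hP.eigenvectorUnitary
  have hUU' : U * Uᴴ = 1 := Unitary.coe_mul_star_self hP.eigenvectorUnitary
  set D : Matrix (Fin m) (Fin m) ℂ := diagonal (RCLike.ofReal ∘ hP.eigenvalues) with hD
  have hspec : P = U * D * Uᴴ := by
    conv_lhs => rw [hP.spectral_theorem]
    rfl
  have hDD : D * D = D := by
    have : D = Uᴴ * P * U := by
      rw [hspec]
      calc D = (Uᴴ * U) * D * (Uᴴ * U) := by rw [hUU]; simp
        _ = _ := by simp only [Matrix.mul_assoc]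
    rw [this]
    calc Uᴴ * P * U * (Uᴴ * P * U) = Uᴴ * P * (U * Uᴴ) * P * U := by simp only [Matrix.mul_assoc]
      _ = Uᴴ * (P * P) * U := by rw [hUU']; simp only [Matrix.mul_assoc, Matrix.one_mul]
      _ = _ := by rw [hPP]
  have hev : ∀ i, hP.eigenvalues i ≠ 0 → hP.eigenvalues i = 1 := by
    intro i hi
    have := congrFun (congrFun hDD i) i
    simp only [hD, diagonal_mul_diagonal, diagonal_apply_eq, Function.comp] at this
    have h2 : hP.eigenvalues i * hP.eigenvalues i = hP.eigenvalues i := by exact_mod_cast this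
    exact mul_left_cancel₀ hi (by rw [h2, mul_one])
  have hcard : Fintype.card (Fin P.rank) = Fintype.card {i // hP.eigenvalues i ≠ 0} := by
    rw [Fintype.card_fin]; exact hP.rank_eq_card_non_zero_eigs
  let e : Fin P.rank ≃ {i // hP.eigenvalues i ≠ 0} := Fintype.equivOfCardEq hcard
  refine ⟨U.submatrix id (fun a => (e a).1), ?_, ?_⟩
  · ext a b
    have := congrFun (congrFun hUU (e a).1) (e b).1
    simp only [mul_apply, conjTranspose_apply, submatrix_apply, id, one_apply] at this ⊢
    rw [this]
    simp [Subtype.val_inj]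
  · ext a b
    conv_rhs => rw [hspec]
    rw [mul_apply, mul_apply]
    simp only [conjTranspose_apply, submatrix_apply, id, hD, mul_diagonal, Function.comp]
    rw [e.sum_comp (fun x : {i // hP.eigenvalues i ≠ 0} => U a x.1 * star (U b x.1))]
    have h1 : ∀ x, U a x * ((hP.eigenvalues x : ℝ) : ℂ) * star (U b x)
        = if hP.eigenvalues x ≠ 0 then U a x * star (U b x) else 0 := by
      intro x
      split_ifs with h
      · rw [hev x h]; simp
      · push Not at h; rw [h]; simp
    have h2 := Finset.sum_subtype (Finset.univ.filter fun x => hP.eigenvalues x ≠ 0)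
      (p := fun x => hP.eigenvalues x ≠ 0) (F := inferInstance) (by simp) (fun x => U a x * star (U b x))
    rw [← h2, Finset.sum_filter]
    exact (Finset.sum_congr rfl fun x _ => (h1 x)).symm

section Structure

variable {I : Type*} [Fintype I] [DecidableEq I] {n : I → ℕ}

/-- Structure of a ⋆-homomorphism `Φ : ⨁ i, M_{n i} → M_m`. There are orthogonal isometries
`W (i, c) : ℂ^{n i} → ℂ^m` intertwining the representations of the summands with `Φ`, as many for
each `i` as the rank of the image of a minimal projection, and their ranges span that of `Φ 1`. -/
theorem exists_intertwiners (hn : ∀ i, 0 < n i) {m : ℕ}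
    (Φ : (∀ i, Matrix (Fin (n i)) (Fin (n i)) ℂ) →⋆ₙₐ[ℂ] Matrix (Fin m) (Fin m) ℂ) :
    ∃ W : ∀ p : (Σ i, Fin (Φ (Pi.single i (Matrix.single ⟨0, hn i⟩ ⟨0, hn i⟩ 1))).rank),
        Matrix (Fin m) (Fin (n p.1)) ℂ,
      IsOrthoIsometries W ∧ (∀ p x, Φ x * W p = W p * x p.1) ∧
      ∑ p, W p * (W p)ᴴ = Φ 1 := by
  classical
  let z : ∀ i, Fin (n i) := fun i => ⟨0, hn i⟩
  let e : ∀ i, Fin (n i) → Fin (n i) → (∀ i, Matrix (Fin (n i)) (Fin (n i)) ℂ) :=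
    fun i a b => Pi.single i (Matrix.single a b 1)
  have he_mul : ∀ i a b c d, e i a b * e i c d = if b = c then e i a d else 0 := by
    intro i a b c d
    simp only [e, ← Pi.single_mul]
    split_ifs with h
    · subst h; simp
    · simp [Matrix.single_mul_single_of_ne _ _ _ _ h]
  have he_star : ∀ i a b, star (e i a b) = e i b a := by
    intro i a b
    ext j : 1
    by_cases hj : j = i
    · subst hj
      simp [e, star_eq_conjTranspose]
    · simp [e, hj]
  have he_ne : ∀ i j a b c d, i ≠ j → e i a b * e j c d = 0 := by
    intro i j a b c d hij
    ext k : 1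
    by_cases hk : k = i
    · subst hk
      simp [e, hij]
    · simp [e, hk]
  have hx_mul : ∀ (x : ∀ i, Matrix (Fin (n i)) (Fin (n i)) ℂ) i b,
      x * e i b (z i) = ∑ a, x i a b • e i a (z i) := by
    intro x i b
    ext j c d
    by_cases hj : j = i
    · subst hj
      simp only [e, Pi.mul_apply, Pi.single_eq_same, Finset.sum_apply, Pi.smul_apply,
        Matrix.sum_apply, Matrix.smul_apply]
      simp [Matrix.mul_apply, Matrix.single_apply, Finset.sum_ite_eq, ite_and]
    · simp [e, hj, Finset.sum_apply]
  have hone : (1 : ∀ i, Matrix (Fin (n i)) (Fin (n i)) ℂ) = ∑ i, ∑ a, e i a a := by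
    ext j c d
    simp only [Finset.sum_apply, e]
    rw [Finset.sum_eq_single j]
    · simp [Matrix.sum_apply, Matrix.single_apply, Matrix.one_apply, ite_and]
    · intro i _ hij
      simp [Pi.single_eq_of_ne hij.symm]
    · simp
  have hstar : ∀ i a b, (Φ (e i a b))ᴴ = Φ (e i b a) := by
    intro i a b
    rw [← star_eq_conjTranspose, ← map_star, he_star]
  have hP : ∀ i, (Φ (e i (z i) (z i))).IsHermitian := fun i => hstar i _ _
  have hPP : ∀ i, Φ (e i (z i) (z i)) * Φ (e i (z i) (z i)) = Φ (e i (z i) (z i)) := by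
    intro i; rw [← map_mul, he_mul, if_pos rfl]
  choose X hX1 hX2 using fun i => exists_isometry_of_projection _ (hP i) (hPP i)
  have hPX : ∀ i, Φ (e i (z i) (z i)) * X i = X i := by
    intro i
    calc _ = X i * (X i)ᴴ * X i := by rw [hX2]
      _ = _ := by rw [Matrix.mul_assoc, hX1, Matrix.mul_one]
  -- the `l`-th column of `W (i, c)` is `Φ (e_{l 0}) ξ_c`, with `ξ_c` the `c`-th column of `X i`
  let W : ∀ p : (Σ i, Fin (Φ (e i (z i) (z i))).rank), Matrix (Fin m) (Fin (n p.1)) ℂ :=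
    fun p => Matrix.of fun r l => (Φ (e p.1 l (z p.1)) * X p.1) r p.2
  have hWW : ∀ p q l l', ((W p)ᴴ * W q) l l'
      = ((X p.1)ᴴ * (Φ (e p.1 (z p.1) l * e q.1 l' (z q.1))) * X q.1) p.2 q.2 := by
    intro p q l l'
    have : ((W p)ᴴ * W q) l l' =
      ((Φ (e p.1 l (z p.1)) * X p.1)ᴴ * (Φ (e q.1 l' (z q.1)) * X q.1)) p.2 q.2 := rfl
    rw [this, conjTranspose_mul, hstar, map_mul]
    simp only [Matrix.mul_assoc]
  refine ⟨W, ⟨?_, ?_⟩, ?_, ?_⟩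
  · intro p
    ext l l'
    rw [hWW, he_mul]
    split_ifs with h
    · subst h
      rw [Matrix.mul_assoc, hPX, hX1, Matrix.one_apply_eq]
      exact (Matrix.one_apply_eq _).symm
    · rw [map_zero, Matrix.mul_zero, Matrix.zero_mul]
      exact (Matrix.one_apply_ne h).symm
  · rintro ⟨i, c⟩ ⟨j, d⟩ hne
    ext l l'
    rw [hWW]
    by_cases hij : i = j
    · subst hij
      have hcd : c ≠ d := fun h => hne (by rw [h])
      simp only [he_mul]
      split_ifs with h
      · rw [Matrix.mul_assoc, hPX, hX1]; simp [hcd]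
      · simp
    · simp [he_ne _ _ _ _ _ _ hij]
  · intro p x
    ext r l
    have h1 : (Φ x * W p) r l = (Φ (x * e p.1 l (z p.1)) * X p.1) r p.2 := by
      rw [map_mul, Matrix.mul_assoc]
      simp [W, Matrix.mul_apply]
    rw [h1, hx_mul, map_sum, Matrix.sum_mul, Matrix.sum_apply]
    simp only [map_smul, Matrix.smul_mul, Matrix.smul_apply, smul_eq_mul]
    rw [Matrix.mul_apply]
    exact Finset.sum_congr rfl fun a _ => mul_comm _ _
  · rw [hone, map_sum, Fintype.sum_sigma]
    refine Finset.sum_congr rfl fun i _ => ?_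
    have h1 : ∀ a, Φ (e i a a) = (Φ (e i a (z i)) * X i) * (Φ (e i a (z i)) * X i)ᴴ := by
      intro a
      rw [conjTranspose_mul, hstar]
      calc Φ (e i a a) = Φ (e i a (z i) * e i (z i) (z i) * e i (z i) a) := by
            rw [he_mul, if_pos rfl, he_mul, if_pos rfl]
        _ = Φ (e i a (z i)) * (X i * (X i)ᴴ) * Φ (e i (z i) a) := by
            rw [map_mul, map_mul, hX2]
        _ = _ := by simp only [Matrix.mul_assoc]
    rw [map_sum]
    simp only [h1]
    ext r s
    simp only [Matrix.sum_apply, Matrix.mul_apply (M := W _),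
      Matrix.mul_apply (M := Φ (e i _ (z i)) * X i), conjTranspose_apply]
    rw [Finset.sum_comm]
    rfl

end Structure

theorem norm_le_one_of_isometry {m n : ℕ} {V : Matrix (Fin m) (Fin n) ℂ} (hV : Vᴴ * V = 1) :
    ‖V‖ ≤ 1 := by
  have h := l2_opNorm_conjTranspose_mul_self V
  rw [hV] at h
  have h1 : ‖(1 : Matrix (Fin n) (Fin n) ℂ)‖ ≤ 1 := by
    rw [← diagonal_one, l2_opNorm_diagonal]
    exact (pi_norm_le_iff_of_nonneg zero_le_one).2 fun i => by simp
  nlinarith [norm_nonneg V]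

theorem norm_compression_le {m n : ℕ} {V : Matrix (Fin m) (Fin n) ℂ} (hV : Vᴴ * V = 1)
    (y : Matrix (Fin m) (Fin m) ℂ) : ‖Vᴴ * y * V‖ ≤ ‖y‖ := by
  have h := norm_le_one_of_isometry hV
  have h' : ‖Vᴴ‖ ≤ 1 := by rwa [l2_opNorm_conjTranspose]
  calc ‖Vᴴ * y * V‖ ≤ ‖Vᴴ * y‖ * ‖V‖ := l2_opNorm_mul _ _
    _ ≤ (‖Vᴴ‖ * ‖y‖) * ‖V‖ := by gcongr; exact l2_opNorm_mul _ _
    _ ≤ (1 * ‖y‖) * 1 := by gcongr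
    _ = ‖y‖ := by ring

/-! ### Block diagonal corners of matrix algebras -/

section Presentation

/-- A map `Φ` from `⨁ i, M_{n i}` to `M_m` is presented by the isometries `W c : ℂ^{n (src c)} → ℂ^m`
if these identify `ℂ^m` with `⨁ c, ℂ^{n (src c)}` in such a way that `Φ x` becomes the block diagonal
matrix with blocks `x (src c)`. -/
def IsPresentedBy {I K : Type*} [Fintype K] {n : I → ℕ} {m : ℕ}
    (Φ : (∀ i, Matrix (Fin (n i)) (Fin (n i)) ℂ) → Matrix (Fin m) (Fin m) ℂ)
    (src : K → I) (W : ∀ c, Matrix (Fin m) (Fin (n (src c))) ℂ) : Prop :=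
  IsOrthoIsometries W ∧ (∀ c x, Φ x * W c = W c * x (src c)) ∧ ∑ c, W c * (W c)ᴴ = 1

namespace IsPresentedBy

variable {I K : Type*} [Fintype K] {n : I → ℕ} {m : ℕ}
  {Φ : (∀ i, Matrix (Fin (n i)) (Fin (n i)) ℂ) → Matrix (Fin m) (Fin m) ℂ}
  {src : K → I} {W : ∀ c, Matrix (Fin m) (Fin (n (src c))) ℂ}

theorem apply_eq_sum (h : IsPresentedBy Φ src W) (x : ∀ i, Matrix (Fin (n i)) (Fin (n i)) ℂ) :
    Φ x = ∑ c, W c * x (src c) * (W c)ᴴ := by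
  calc Φ x = Φ x * ∑ c, W c * (W c)ᴴ := by rw [h.2.2, Matrix.mul_one]
    _ = _ := by
      rw [Matrix.mul_sum]
      exact Finset.sum_congr rfl fun c _ => by rw [← Matrix.mul_assoc, h.2.1]

theorem conjTranspose_mul_apply (h : IsPresentedBy Φ src W) (c : K)
    (x : ∀ i, Matrix (Fin (n i)) (Fin (n i)) ℂ) : (W c)ᴴ * Φ x = x (src c) * (W c)ᴴ := by
  classical
  rw [h.apply_eq_sum, Matrix.mul_sum, Finset.sum_eq_single c]
  · rw [← Matrix.mul_assoc, ← Matrix.mul_assoc, h.1.1, Matrix.one_mul]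
  · intro d _ hd
    rw [← Matrix.mul_assoc, ← Matrix.mul_assoc, h.1.2 c d hd.symm, Matrix.zero_mul,
      Matrix.zero_mul]
  · simp

end IsPresentedBy

/-- If `Φ j` is block diagonal with blocks indexed by `K j`, the family `R` places the
algebra `⨁ i, M_{n i}` in a corner of `M_s`, and the `U a` are intertwiners
`ℂ^s → ℂ^{s'}`, then this family places `⨁ j, M_{n' j}` in a corner of `M_{s'}`. -/
def transport {I J : Type*} {K : J → Type*} [∀ j, Fintype (K j)] {n : I → ℕ} {n' : J → ℕ}
    {s s' : ℕ} (src : ∀ j, K j → I) (W : ∀ j c, Matrix (Fin (n' j)) (Fin (n (src j c))) ℂ)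
    (U : (Σ j, K j) → Matrix (Fin s') (Fin s) ℂ) (R : ∀ i, Matrix (Fin s) (Fin (n i)) ℂ) (j : J) :
    Matrix (Fin s') (Fin (n' j)) ℂ :=
  ∑ c, U ⟨j, c⟩ * R (src j c) * (W j c)ᴴ

variable {I J : Type*} {K : J → Type*} [∀ j, Fintype (K j)] {n : I → ℕ} {n' : J → ℕ}
  {s s' : ℕ} {src : ∀ j, K j → I} {W : ∀ j c, Matrix (Fin (n' j)) (Fin (n (src j c))) ℂ}
  {U : (Σ j, K j) → Matrix (Fin s') (Fin s) ℂ} {R : ∀ i, Matrix (Fin s) (Fin (n i)) ℂ}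
  {Φ : ∀ j, (∀ i, Matrix (Fin (n i)) (Fin (n i)) ℂ) → Matrix (Fin (n' j)) (Fin (n' j)) ℂ}

/-- Compression by the transported isometries undoes the intertwiners `U`, up to the map `Φ`. This
makes the compressions on consecutive levels compatible with the connecting maps. -/
theorem transport_compression (hU : IsOrthoIsometries U)
    (hΦ : ∀ j, IsPresentedBy (Φ j) (src j) (W j))
    {b : Matrix (Fin s) (Fin s) ℂ} {b' : Matrix (Fin s') (Fin s') ℂ}
    (hb : ∀ a, b' * U a = U a * b) (j : J) :
    (transport src W U R j)ᴴ * b' * transport src W U R j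
      = Φ j (fun i => (R i)ᴴ * b * R i) := by
  classical
  rw [(hΦ j).apply_eq_sum]
  simp only [transport, conjTranspose_sum, Matrix.sum_mul, Matrix.mul_sum, conjTranspose_mul,
    conjTranspose_conjTranspose]
  rw [Finset.sum_comm]
  refine Finset.sum_congr rfl fun c _ => ?_
  have key : ∀ d, W j c * ((R (src j c))ᴴ * (U ⟨j, c⟩)ᴴ) * b' * (U ⟨j, d⟩ * R (src j d) * (W j d)ᴴ)
      = W j c * (R (src j c))ᴴ * ((U ⟨j, c⟩)ᴴ * U ⟨j, d⟩) * b * R (src j d) * (W j d)ᴴ := by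
    intro d
    calc _ = W j c * (R (src j c))ᴴ * (U ⟨j, c⟩)ᴴ * (b' * U ⟨j, d⟩) * R (src j d) * (W j d)ᴴ := by
          simp only [Matrix.mul_assoc]
      _ = _ := by rw [hb]; simp only [Matrix.mul_assoc]
  simp only [key]
  rw [Finset.sum_eq_single c]
  · rw [hU.1]; simp only [Matrix.mul_assoc, Matrix.one_mul]
  · intro d _ hd
    rw [hU.2 _ _ (by simpa using hd.symm)]; simp
  · simp

theorem transport_isOrthoIsometries (hU : IsOrthoIsometries U)
    (hΦ : ∀ j, IsPresentedBy (Φ j) (src j) (W j)) (hR : IsOrthoIsometries R) :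
    IsOrthoIsometries (transport src W U R) := by
  constructor
  · intro j
    have h := transport_compression (R := R) hU hΦ (b := 1) (b' := 1) (by simp) j
    rw [Matrix.mul_one] at h
    rw [h, (hΦ j).apply_eq_sum]
    simp only [Matrix.mul_one, hR.1]
    exact (hΦ j).2.2
  · intro j j' hj
    simp only [transport, conjTranspose_sum, Matrix.sum_mul, Matrix.mul_sum, conjTranspose_mul]
    refine Finset.sum_eq_zero fun c _ => Finset.sum_eq_zero fun d _ => ?_
    calc _ = (W j d)ᴴᴴ * (R (src j d))ᴴ * ((U ⟨j, d⟩)ᴴ * U ⟨j', c⟩) * R (src j' c) * (W j' c)ᴴ := by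
          simp only [Matrix.mul_assoc]
      _ = 0 := by
        rw [hU.2 _ _ (by intro h; exact hj (congrArg Sigma.fst h))]; simp

/-- If the ranges of the `R i` reduce `b`, which acts on them as `x`, then the ranges of the transported
isometries reduce `b'`, which acts on them as `Φ x`. -/
theorem mul_transport (hΦ : ∀ j, IsPresentedBy (Φ j) (src j) (W j))
    {b : Matrix (Fin s) (Fin s) ℂ} {b' : Matrix (Fin s') (Fin s') ℂ}
    (hb : ∀ a, b' * U a = U a * b) {x : ∀ i, Matrix (Fin (n i)) (Fin (n i)) ℂ}
    (hx : ∀ i, b * R i = R i * x i) (j : J) :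
    b' * transport src W U R j = transport src W U R j * Φ j x := by
  simp only [transport, Matrix.sum_mul, Matrix.mul_sum]
  refine Finset.sum_congr rfl fun c _ => ?_
  calc b' * (U ⟨j, c⟩ * R (src j c) * (W j c)ᴴ)
      = (b' * U ⟨j, c⟩) * R (src j c) * (W j c)ᴴ := by simp only [Matrix.mul_assoc]
    _ = U ⟨j, c⟩ * (b * R (src j c)) * (W j c)ᴴ := by rw [hb]; simp only [Matrix.mul_assoc]
    _ = U ⟨j, c⟩ * R (src j c) * (x (src j c) * (W j c)ᴴ) := by
        rw [hx]; simp only [Matrix.mul_assoc]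
    _ = _ := by rw [← (hΦ j).conjTranspose_mul_apply]; simp only [Matrix.mul_assoc]

end Presentation

section Corner

variable {I : Type*} [Fintype I] {n : I → ℕ} {s : ℕ}

/-- The embedding of `⨁ i, M_{n i}` as a block diagonal corner of `M_s` given by a family of
isometries with orthogonal ranges. -/
def cornerEmbedding (R : ∀ i, Matrix (Fin s) (Fin (n i)) ℂ) (hR : IsOrthoIsometries R) :
    (∀ i, Matrix (Fin (n i)) (Fin (n i)) ℂ) →⋆ₙₐ[ℂ] Matrix (Fin s) (Fin s) ℂ where
  toFun x := ∑ i, R i * x i * (R i)ᴴ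
  map_smul' c x := by simp [Finset.smul_sum]
  map_zero' := by simp
  map_add' x y := by simp [Matrix.mul_add, Matrix.add_mul, Finset.sum_add_distrib]
  map_mul' x y := by
    classical
    simp only [Matrix.sum_mul, Matrix.mul_sum]
    refine Finset.sum_congr rfl fun i _ => ?_
    rw [Finset.sum_eq_single i]
    · calc R i * (x i * y i) * (R i)ᴴ
          = R i * x i * (1 : Matrix (Fin (n i)) (Fin (n i)) ℂ) * y i * (R i)ᴴ := by
            rw [Matrix.mul_one]; simp only [Matrix.mul_assoc]
        _ = _ := by rw [← hR.1 i]; simp only [Matrix.mul_assoc]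
    · intro k _ hk
      calc _ = R k * x k * ((R k)ᴴ * R i) * y i * (R i)ᴴ := by simp only [Matrix.mul_assoc]
        _ = 0 := by rw [hR.2 _ _ hk]; simp
    · simp
  map_star' x := by
    simp [star_eq_conjTranspose, conjTranspose_mul, Matrix.mul_assoc]

theorem cornerEmbedding_mul (R : ∀ i, Matrix (Fin s) (Fin (n i)) ℂ) (hR : IsOrthoIsometries R)
    (x : ∀ i, Matrix (Fin (n i)) (Fin (n i)) ℂ) (i : I) :
    cornerEmbedding R hR x * R i = R i * x i := by
  classical
  change (∑ i, R i * x i * (R i)ᴴ) * R i = _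
  rw [Matrix.sum_mul, Finset.sum_eq_single i]
  · rw [Matrix.mul_assoc, hR.1, Matrix.mul_one]
  · intro k _ hk
    rw [Matrix.mul_assoc, hR.2 _ _ hk, Matrix.mul_zero]
  · simp

end Corner

/-! ### Maps on direct limits -/

theorem norm_add_eq_max_of_orthogonal {B : Type*} [NonUnitalCStarAlgebra B] {a b : B}
    (h1 : star a * b = 0) (h2 : a * star b = 0) : ‖a + b‖ = max ‖a‖ ‖b‖ := by
  have h1' : star b * a = 0 := by simpa using congrArg star h1
  have h2' : b * star a = 0 := by simpa using congrArg star h2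
  have e : star (a + b) * (a + b) = star a * a + star b * b := by
    rw [star_add, add_mul, mul_add, mul_add, h1, h1']; simp
  have hab : (star a * a) * (star b * b) = 0 := by
    rw [mul_assoc, ← mul_assoc a, h2]; simp
  have hba : (star b * b) * (star a * a) = 0 := by
    rw [mul_assoc, ← mul_assoc b, h2']; simp
  have hmax := IsStarNormal.norm_add_eq_max (IsSelfAdjoint.star_mul_self a).isStarNormal
    (IsSelfAdjoint.star_mul_self b).isStarNormal (hab.trans hba.symm) hab
  rw [← e, CStarRing.norm_star_mul_self, CStarRing.norm_star_mul_self,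
    CStarRing.norm_star_mul_self] at hmax
  rw [← mul_self_inj_of_nonneg (norm_nonneg _) (le_max_of_le_left (norm_nonneg _)), hmax]
  rcases le_total ‖a‖ ‖b‖ with h | h
  · rw [max_eq_right h, max_eq_right (mul_self_le_mul_self (norm_nonneg _) h)]
  · rw [max_eq_left h, max_eq_left (mul_self_le_mul_self (norm_nonneg _) h)]

/-- Let `j k : V k → B` be ⋆-homomorphisms that become compatible with the connecting maps `φ k` only
after cutting down by the projections `j (k + 1) 1`. Contractive left inverses `E k` of the `φ k`
allow to correct them to linear contractions `i k` which are compatible with the `φ k` and have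
`j k` as their corner: on the complement of `j (k + 1) 1`, the map `i (k + 1)` is `i k ∘ E k`, and
orthogonality of the two parts keeps the norm bounded by `1`. -/
theorem exists_compatible_lifting {B : Type*} [NonUnitalCStarAlgebra B] {V : ℕ → Type*}
    [∀ k, CStarAlgebra (V k)] (φ : ∀ k, V k →⋆ₐ[ℂ] V (k + 1)) (E : ∀ k, V (k + 1) →ₗ[ℂ] V k)
    (hE : ∀ k x, E k (φ k x) = x) (hE_norm : ∀ k y, ‖E k y‖ ≤ ‖y‖)
    (j : ∀ k, V k →⋆ₙₐ[ℂ] B) (hj : ∀ k x, j k x * j (k + 1) 1 = j (k + 1) (φ k x))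
    (M : ℕ → NonUnitalSubalgebra ℂ B) (hM : Monotone M) (hjM : ∀ k x, j k x ∈ M k) :
    ∃ i : ∀ k, V k →ₗ[ℂ] B, (∀ k x, i (k + 1) (φ k x) = i k x) ∧ (∀ k x, ‖i k x‖ ≤ ‖x‖) ∧
      (∀ k x, j k 1 * i k x = j k x) ∧ ∀ k x, i k x ∈ M k := by
  have hj' : ∀ k x, j (k + 1) 1 * j k x = j (k + 1) (φ k x) := by
    intro k x
    have := congrArg star (hj k (star x))
    simpa [← map_star] using this
  have hj1 : ∀ k x, j k 1 * j k x = j k x := fun k x => by rw [← map_mul, one_mul]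
  have hj2 : ∀ k x, j k x * j k 1 = j k x := fun k x => by rw [← map_mul, mul_one]
  have hrr : ∀ k, j k 1 * j (k + 1) 1 = j (k + 1) 1 := fun k => by rw [hj, map_one]
  have hrr' : ∀ k, j (k + 1) 1 * j k 1 = j (k + 1) 1 := fun k => by rw [hj', map_one]
  have hr : ∀ k, star (j k 1) = j k 1 := fun k => by rw [← map_star, star_one]
  let i : ∀ k, V k →ₗ[ℂ] B := fun k => Nat.rec (motive := fun k => V k →ₗ[ℂ] B)
    (j 0 : V 0 →ₗ[ℂ] B)
    (fun k ik => (j (k + 1) : V (k + 1) →ₗ[ℂ] B) +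
      (ik ∘ₗ E k - LinearMap.mulLeft ℂ (j (k + 1) 1) ∘ₗ ik ∘ₗ E k)) k
  have i0 : ∀ x, i 0 x = j 0 x := fun x => rfl
  have is : ∀ k y, i (k + 1) y
      = j (k + 1) y + (i k (E k y) - j (k + 1) 1 * i k (E k y)) := fun k y => rfl
  have hcomm : ∀ k a x, j k 1 * a = j k x → a * j k 1 = j k x →
      a * j (k + 1) 1 = j (k + 1) 1 * a := by
    intro k a x h1 h2
    calc a * j (k + 1) 1 = a * j k 1 * j (k + 1) 1 := by rw [mul_assoc, hrr]
      _ = j (k + 1) 1 * (j k 1 * a) := by rw [h2, h1, hj, hj']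
      _ = _ := by rw [← mul_assoc, hrr']
  have hl : ∀ k x, j k 1 * i k x = j k x ∧ i k x * j k 1 = j k x := by
    intro k
    induction k with
    | zero => intro x; rw [i0]; exact ⟨hj1 _ _, hj2 _ _⟩
    | succ k ih =>
      intro y
      have hc : i k (E k y) * j (k + 1) 1 = j (k + 1) 1 * i k (E k y) :=
        hcomm k _ _ (ih _).1 (ih _).2
      constructor
      · rw [is, mul_add, mul_sub, hj1, ← mul_assoc, hj1, sub_self, add_zero]
      · rw [is, add_mul, sub_mul, hj2, mul_assoc, hc, ← mul_assoc, hj1, sub_self, add_zero]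
  have hc : ∀ k x, i k x * j (k + 1) 1 = j (k + 1) 1 * i k x :=
    fun k x => hcomm k _ _ (hl k x).1 (hl k x).2
  refine ⟨i, ?_, ?_, fun k x => (hl k x).1, ?_⟩
  · intro k x
    have : j (k + 1) 1 * i k x = j (k + 1) (φ k x) := by
      rw [← hrr' k, mul_assoc, (hl k x).1, hj']
    rw [is, hE, this]
    abel
  · intro k
    induction k with
    | zero => intro x; rw [i0]; exact NonUnitalStarAlgHom.norm_apply_le _ _
    | succ k ih =>
      intro y
      have hrrz : ∀ z, j (k + 1) 1 * (z - j (k + 1) 1 * z) = 0 := fun z => by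
        rw [mul_sub, ← mul_assoc, hj1, sub_self]
      -- `i k (E k y)` commutes with the projection `j (k + 1) 1`, so it splits orthogonally
      have hcut : ‖i k (E k y) - j (k + 1) 1 * i k (E k y)‖ ≤ ‖i k (E k y)‖ := by
        have := norm_add_eq_max_of_orthogonal (a := j (k + 1) 1 * i k (E k y))
          (b := i k (E k y) - j (k + 1) 1 * i k (E k y))
          (by rw [star_mul, hr, mul_assoc, hrrz, mul_zero])
          (by rw [← hc, star_sub, star_mul, hr, mul_assoc, hrrz, mul_zero])
        rw [add_sub_cancel] at this
        rw [this]
        exact le_max_right _ _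
      rw [is, norm_add_eq_max_of_orthogonal]
      · exact max_le (NonUnitalStarAlgHom.norm_apply_le _ _)
          (hcut.trans ((ih _).trans (hE_norm k y)))
      · have : star (j (k + 1) y) = star (j (k + 1) y) * j (k + 1) 1 := by
          rw [← map_star, hj2]
        rw [this, mul_assoc, hrrz, mul_zero]
      · rw [← hc, star_sub, star_mul, hr]
        nth_rewrite 1 [← hj2]
        rw [mul_assoc, hrrz, mul_zero]
  · intro k
    induction k with
    | zero => intro x; rw [i0]; exact hjM _ _
    | succ k ih =>
      intro y
      rw [is]
      have h := hM (Nat.le_succ k) (ih (E k y))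
      exact add_mem (hjM _ _) (sub_mem h (mul_mem (hjM _ _) h))

/-- Compatible and uniformly bounded linear maps on an increasing sequence of subspaces with dense union
extend to the whole space. The graphs of the given maps form an increasing union, which is the
domain of the map that is extended by continuity. -/
theorem exists_extension {Y Z : Type*} [NormedAddCommGroup Y] [NormedSpace ℂ Y]
    [NormedAddCommGroup Z] [NormedSpace ℂ Z] [CompleteSpace Z] {V : ℕ → Type*}
    [∀ k, AddCommGroup (V k)] [∀ k, Module ℂ (V k)] (κ : ∀ k, V k →ₗ[ℂ] Y)
    (f : ∀ k, V k →ₗ[ℂ] Z) (C : ℝ) (hb : ∀ k x, ‖f k x‖ ≤ C * ‖κ k x‖)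
    (hs : ∀ k x, ∃ x', κ (k + 1) x' = κ k x ∧ f (k + 1) x' = f k x)
    (hd : Dense (⋃ k, Set.range (κ k))) :
    ∃ F : Y →L[ℂ] Z, ∀ k x, F (κ k x) = f k x := by
  have hs' : ∀ k l, k ≤ l → ∀ x, ∃ x', κ l x' = κ k x ∧ f l x' = f k x := by
    intro k l hkl
    induction l, hkl using Nat.le_induction with
    | base => exact fun x => ⟨x, rfl, rfl⟩
    | succ l _ ih =>
      intro x
      obtain ⟨y, h1, h2⟩ := ih x
      obtain ⟨z, h3, h4⟩ := hs l y
      exact ⟨z, h3.trans h1, h4.trans h2⟩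
  let G : Submodule ℂ (Y × Z) :=
    { carrier := {q | ∃ k x, q = (κ k x, f k x)}
      zero_mem' := ⟨0, 0, by simp; rfl⟩
      add_mem' := by
        rintro _ _ ⟨k, x, rfl⟩ ⟨l, y, rfl⟩
        obtain ⟨x', h1, h2⟩ := hs' k (max k l) (le_max_left _ _) x
        obtain ⟨y', h3, h4⟩ := hs' l (max k l) (le_max_right _ _) y
        exact ⟨max k l, x' + y', by simp [h1, h2, h3, h4]⟩
      smul_mem' := by
        rintro c _ ⟨k, x, rfl⟩
        exact ⟨k, c • x, by simp⟩ }
  let e : G →ₗ[ℂ] Y := LinearMap.fst ℂ Y Z ∘ₗ G.subtype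
  let g : G →ₗ[ℂ] Z := LinearMap.snd ℂ Y Z ∘ₗ G.subtype
  have hdense : DenseRange e := by
    refine hd.mono ?_
    rintro _ ⟨_, ⟨k, rfl⟩, x, rfl⟩
    exact ⟨⟨(κ k x, f k x), k, x, rfl⟩, rfl⟩
  have hnorm : ∃ C, ∀ q, ‖g q‖ ≤ C * ‖e q‖ := by
    refine ⟨C, ?_⟩
    rintro ⟨_, k, x, rfl⟩
    exact hb k x
  exact ⟨g.extendOfNorm e, fun k x =>
    LinearMap.extendOfNorm_eq hdense hnorm ⟨(κ k x, f k x), k, x, rfl⟩⟩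

/-! ### Paths in the Bratteli diagram and intertwining isometries -/

theorem BratteliDiagram.numPaths_eq_zero (D : BratteliDiagram) (v : D.Vertex) :
    ∀ m (w : Fin (D.width m)), m < v.1 → D.numPaths v m w = 0
  | 0, w, h => by
    rw [BratteliDiagram.numPaths, if_neg]
    rintro rfl
    exact lt_irrefl _ h
  | m + 1, w, h => by
    rw [BratteliDiagram.numPaths, if_neg]
    · simp [D.numPaths_eq_zero v m _ (Nat.lt_of_succ_lt h)]
    · rintro rfl
      exact lt_irrefl _ h

theorem IsOrthoIsometries.comp {m n : ℕ} {α : Type*} {β : α → Type*} {s : α → ℕ}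
    {X : ∀ a, Matrix (Fin m) (Fin (s a)) ℂ} {Y : ∀ a, β a → Matrix (Fin (s a)) (Fin n) ℂ}
    (hX : IsOrthoIsometries X) (hY : ∀ a, IsOrthoIsometries (Y a)) :
    IsOrthoIsometries (fun p : (Σ a, β a) => X p.1 * Y p.1 p.2) := by
  constructor
  · rintro ⟨a, c⟩
    calc (X a * Y a c)ᴴ * (X a * Y a c) = (Y a c)ᴴ * ((X a)ᴴ * X a) * Y a c := by
          simp only [conjTranspose_mul, Matrix.mul_assoc]
      _ = 1 := by rw [hX.1, Matrix.mul_one, (hY a).1]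
  · rintro ⟨a, c⟩ ⟨b, d⟩ hne
    calc (X a * Y a c)ᴴ * (X b * Y b d) = (Y a c)ᴴ * ((X a)ᴴ * X b) * Y b d := by
          simp only [conjTranspose_mul, Matrix.mul_assoc]
      _ = 0 := by
        by_cases hab : a = b
        · subst hab
          rw [hX.1, Matrix.mul_one, (hY a).2 _ _ (fun h => hne (by rw [h]))]
        · rw [hX.2 _ _ hab, Matrix.mul_zero, Matrix.zero_mul]

namespace AFSystem

variable {B : Type*} [NonUnitalCStarAlgebra B] {T : AFSystem} {κ : ∀ k, T.Alg k →⋆ₙₐ[ℂ] B}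

theorem exists_lift (hκ : ∀ k x, κ (k + 1) (T.map k x) = κ k x) {k l : ℕ} (hkl : k ≤ l)
    (b : T.Alg k) : ∃ b' : T.Alg l, κ l b' = κ k b := by
  induction l, hkl using Nat.le_induction with
  | base => exact ⟨b, rfl⟩
  | succ l _ ih =>
    obtain ⟨b', hb'⟩ := ih
    exact ⟨T.map l b', by rw [hκ, hb']⟩

/-- There are `N` isometries with orthogonal ranges intertwining the representation of `B_k` on
its summand `v` with the restriction to `B_k` of the representation of `B_l` on its summand `w`.
The connecting map `B_k → B_l` is expressed through the embeddings `κ` into the limit. -/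
def HasIntertwiners (T : AFSystem) (κ : ∀ k, T.Alg k →⋆ₙₐ[ℂ] B) (v w : Σ k, Fin (T.width k))
    (N : ℕ) : Prop :=
  ∃ U : Fin N → Matrix (Fin (T.size w.1 w.2)) (Fin (T.size v.1 v.2)) ℂ, IsOrthoIsometries U ∧
    ∀ a b b', κ v.1 b = κ w.1 b' → b' w.2 * U a = U a * b v.2

theorem HasIntertwiners.of_card_le {v w : Σ k, Fin (T.width k)} {N : ℕ} {α : Type*} [Fintype α]
    (hα : N ≤ Fintype.card α)
    (U : α → Matrix (Fin (T.size w.1 w.2)) (Fin (T.size v.1 v.2)) ℂ) (hU : IsOrthoIsometries U)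
    (h : ∀ a b b', κ v.1 b = κ w.1 b' → b' w.2 * U a = U a * b v.2) :
    T.HasIntertwiners κ v w N := by
  obtain ⟨f⟩ : Nonempty (Fin N ↪ α) :=
    Function.Embedding.nonempty_of_card_le (by rwa [Fintype.card_fin])
  exact ⟨fun a => U (f a), ⟨fun a => hU.1 _, fun a b hab => hU.2 _ _ (f.injective.ne hab)⟩,
    fun a => h _⟩

theorem HasIntertwiners.exists_family {v w : Σ k, Fin (T.width k)} {N : ℕ}
    (h : T.HasIntertwiners κ v w N) {α : Type*} [Fintype α] (hα : Fintype.card α ≤ N) :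
    ∃ U : α → Matrix (Fin (T.size w.1 w.2)) (Fin (T.size v.1 v.2)) ℂ, IsOrthoIsometries U ∧
      ∀ a b b', κ v.1 b = κ w.1 b' → b' w.2 * U a = U a * b v.2 := by
  obtain ⟨U, hU, hb⟩ := h
  obtain ⟨f⟩ : Nonempty (α ↪ Fin N) :=
    Function.Embedding.nonempty_of_card_le (by rwa [Fintype.card_fin])
  exact ⟨fun a => U (f a), ⟨fun a => hU.1 _, fun a b hab => hU.2 _ _ (f.injective.ne hab)⟩,
    fun a => hb _⟩

theorem HasIntertwiners.refl (hinj : ∀ k, Function.Injective (κ k)) (v : Σ k, Fin (T.width k)) :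
    T.HasIntertwiners κ v v 1 := by
  refine ⟨fun _ => 1, ⟨fun _ => by simp, fun a b hab => absurd (Subsingleton.elim a b) hab⟩, ?_⟩
  intro a b b' h
  rw [hinj _ h, Matrix.mul_one, Matrix.one_mul]

theorem HasIntertwiners.trans (hκ : ∀ k x, κ (k + 1) (T.map k x) = κ k x)
    {u v w : Σ k, Fin (T.width k)} {N M : ℕ} (huv : T.HasIntertwiners κ u v N) (hle : u.1 ≤ v.1)
    (hvw : T.HasIntertwiners κ v w M) : T.HasIntertwiners κ u w (N * M) := by
  obtain ⟨U, hU, hUb⟩ := huv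
  obtain ⟨V, hV, hVb⟩ := hvw
  refine .of_card_le (α := Σ _ : Fin M, Fin N) (by simp [mul_comm]) (fun a => V a.1 * U a.2)
    (IsOrthoIsometries.comp (β := fun _ => Fin N) (X := V) (Y := fun _ => U) hV fun _ => hU) ?_
  rintro ⟨c, a⟩ b b' hb
  obtain ⟨b'', hb''⟩ := exists_lift hκ hle b
  rw [← Matrix.mul_assoc, hVb c b'' b' (hb''.trans hb), Matrix.mul_assoc, hUb a b b'' hb''.symm,
    Matrix.mul_assoc]

/-- The number of downward paths in the Bratteli diagram of the system, with the vertices typed by the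
widths of the system itself. -/
noncomputable def pathCount (T : AFSystem) (v : Σ k, Fin (T.width k)) (m : ℕ)
    (w : Fin (T.width m)) : ℕ :=
  T.bratteli.numPaths v m w

theorem pathCount_zero (T : AFSystem) (v : Σ k, Fin (T.width k)) (w : Fin (T.width 0)) :
    T.pathCount v 0 w = if v = ⟨0, w⟩ then 1 else 0 := rfl

theorem pathCount_succ (T : AFSystem) (v : Σ k, Fin (T.width k)) (m : ℕ)
    (w : Fin (T.width (m + 1))) :
    T.pathCount v (m + 1) w = (if v = ⟨m + 1, w⟩ then 1 else 0) +
      ∑ u, T.pathCount v m u * T.mult m u w := rfl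

theorem pathCount_eq_zero (T : AFSystem) (v : Σ k, Fin (T.width k)) {m : ℕ} (hm : m < v.1)
    (w : Fin (T.width m)) : T.pathCount v m w = 0 :=
  T.bratteli.numPaths_eq_zero v m w hm

/-- Every downward path contributes one isometry, the composite of the isometries belonging to its
edges. -/
theorem hasIntertwiners_pathCount (hinj : ∀ k, Function.Injective (κ k))
    (hκ : ∀ k x, κ (k + 1) (T.map k x) = κ k x) (v : Σ k, Fin (T.width k)) :
    ∀ m (w : Fin (T.width m)), T.HasIntertwiners κ v ⟨m, w⟩ (T.pathCount v m w) := by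
  intro m
  have h0 : ∀ w, T.HasIntertwiners κ v w 0 := fun w =>
    ⟨Fin.elim0, ⟨fun a => a.elim0, fun a => a.elim0⟩, fun a => a.elim0⟩
  induction m with
  | zero =>
    intro w
    rw [pathCount_zero]
    split_ifs with h
    · subst h; exact .refl hinj _
    · exact h0 _
  | succ m ih =>
    intro w
    rw [pathCount_succ]
    rcases Nat.lt_or_ge m v.1 with hm | hm
    · simp only [T.pathCount_eq_zero v hm, zero_mul, Finset.sum_const_zero, add_zero]
      split_ifs with h
      · subst h; exact .refl hinj _
      · exact h0 _
    · rw [if_neg (by rintro rfl; simp at hm), zero_add]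
      obtain ⟨W, hW, hWb⟩ : ∃ W : ∀ p : (Σ u, Fin (T.mult m u w)),
          Matrix (Fin (T.size (m + 1) w)) (Fin (T.size m p.1)) ℂ,
          IsOrthoIsometries W ∧ ∀ p b, T.map m b w * W p = W p * b p.1 := by
        obtain ⟨W, hW, hWb, -⟩ := exists_intertwiners (T.size_pos m)
          ((Pi.evalNonUnitalStarAlgHom ℂ _ w).comp (T.map m))
        exact ⟨W, hW, hWb⟩
      choose U hU hUb using ih
      refine .of_card_le
        (α := Σ p : (Σ u, Fin (T.mult m u w)), Fin (T.pathCount v m p.1)) ?_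
        (fun q => W q.1 * U q.1.1 q.2) (IsOrthoIsometries.comp (X := W) (Y := fun p => U p.1) hW fun p => hU p.1) ?_
      · simp [Fintype.sum_sigma, mul_comm]
      · rintro ⟨⟨u, c⟩, a⟩ b b' hb
        obtain ⟨b'', hb''⟩ := exists_lift hκ hm b
        obtain rfl : T.map m b'' = b' := hinj (m + 1) (by rw [hκ, hb'']; exact hb)
        change T.map m b'' w * (W ⟨u, c⟩ * U u a) = W ⟨u, c⟩ * U u a * b v.2
        rw [← Matrix.mul_assoc, hWb, Matrix.mul_assoc, hUb u a b b'' hb''.symm, Matrix.mul_assoc]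

/-- Along the vertices provided by the Fermion property, the number of orthogonal intertwiners grows
exponentially. -/
theorem hasIntertwiners_pow (hinj : ∀ k, Function.Injective (κ k))
    (hκ : ∀ k x, κ (k + 1) (T.map k x) = κ k x) {v : ℕ → Σ k, Fin (T.width k)}
    (hv : StrictMono fun t => (v t).1)
    (hpath : ∀ t, 1 < T.pathCount (v t) (v (t + 1)).1 (v (t + 1)).2) (t N : ℕ) :
    T.HasIntertwiners κ (v t) (v (t + N)) (2 ^ N) := by
  induction N with
  | zero => exact .refl hinj _
  | succ N ih =>
    have h := hasIntertwiners_pathCount hinj hκ (v (t + N)) (v (t + N + 1)).1 (v (t + N + 1)).2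
    obtain ⟨U, hU, hUb⟩ := h.exists_family (α := Fin 2) (by rw [Fintype.card_fin]; exact hpath (t + N))
    exact ih.trans hκ (hv.monotone (Nat.le_add_right t N))
      (.of_card_le (by simp) U hU hUb)

end AFSystem

/-! ### Complemented embedding of unital systems -/

section Presentation

variable {I : Type*} [Fintype I] [DecidableEq I] {n : I → ℕ}

/-- A unital ⋆-homomorphism into a matrix algebra is, up to a unitary, block diagonal. -/
theorem exists_presentation (hn : ∀ i, 0 < n i) {m : ℕ}
    (Φ : (∀ i, Matrix (Fin (n i)) (Fin (n i)) ℂ) →⋆ₐ[ℂ] Matrix (Fin m) (Fin m) ℂ) :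
    ∃ (μ : I → ℕ) (W : ∀ p : (Σ i, Fin (μ i)), Matrix (Fin m) (Fin (n p.1)) ℂ),
      IsPresentedBy Φ Sigma.fst W := by
  obtain ⟨W, hW, hWx, hW1⟩ := exists_intertwiners hn
    (Φ : (∀ i, Matrix (Fin (n i)) (Fin (n i)) ℂ) →⋆ₙₐ[ℂ] Matrix (Fin m) (Fin m) ℂ)
  exact ⟨_, W, hW, hWx, hW1.trans (map_one Φ)⟩

variable {J : Type*} [Fintype J] {n' : J → ℕ}

/-- An injective unital ⋆-homomorphism has a contractive linear left inverse: compress to one block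
for each summand of the domain. -/
theorem exists_expectation (hn : ∀ i, 0 < n i)
    (Φ : (∀ i, Matrix (Fin (n i)) (Fin (n i)) ℂ) →⋆ₐ[ℂ] ∀ j, Matrix (Fin (n' j)) (Fin (n' j)) ℂ)
    (hΦ : Function.Injective Φ) {μ : J → I → ℕ}
    {W : ∀ j, ∀ p : (Σ i, Fin (μ j i)), Matrix (Fin (n' j)) (Fin (n p.1)) ℂ}
    (hW : ∀ j, IsPresentedBy (fun x => Φ x j) Sigma.fst (W j)) :
    ∃ E : (∀ j, Matrix (Fin (n' j)) (Fin (n' j)) ℂ) →ₗ[ℂ] ∀ i, Matrix (Fin (n i)) (Fin (n i)) ℂ,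
      (∀ x, E (Φ x) = x) ∧ ∀ y, ‖E y‖ ≤ ‖y‖ := by
  -- by injectivity, every summand on the left occurs in some summand on the right
  have h : ∀ i, ∃ j, Nonempty (Fin (μ j i)) := by
    intro i
    by_contra! h
    have h0 : Φ (Pi.single i 1) = 0 := by
      funext j
      refine ((hW j).apply_eq_sum _).trans (Finset.sum_eq_zero ?_)
      rintro ⟨i', c⟩ _
      have : i' ≠ i := by rintro rfl; exact (h j).false c
      simp [this]
    have h1 : (Pi.single i 1 : ∀ i, Matrix (Fin (n i)) (Fin (n i)) ℂ) = 0 :=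
      hΦ (h0.trans (map_zero Φ).symm)
    have h2 := congrFun (congrFun (congrFun h1 i) ⟨0, hn i⟩) ⟨0, hn i⟩
    simp at h2
  choose j c using h
  let c' : ∀ i, Fin (μ (j i) i) := fun i => (c i).some
  let V : ∀ i, Matrix (Fin (n' (j i))) (Fin (n i)) ℂ := fun i => W (j i) ⟨i, c' i⟩
  have hV : ∀ i, (V i)ᴴ * V i = 1 := fun i => (hW (j i)).1.1 ⟨i, c' i⟩
  refine ⟨{ toFun := fun y i => (V i)ᴴ * y (j i) * V i, map_add' := ?_, map_smul' := ?_ }, ?_, ?_⟩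
  · intro x y
    funext i
    simp [Matrix.mul_add, Matrix.add_mul]
  · intro a x
    funext i
    simp
  · intro x
    funext i
    have := (hW (j i)).2.1 ⟨i, c' i⟩ x
    change (V i)ᴴ * Φ x (j i) * V i = x i
    rw [Matrix.mul_assoc, this, ← Matrix.mul_assoc, hV, Matrix.one_mul]
  · intro y
    refine (pi_norm_le_iff_of_nonneg (norm_nonneg _)).2 fun i => ?_
    exact (norm_compression_le (hV i) _).trans (norm_le_pi_norm y (j i))

end Presentation

/-- The inclusion of one factor in a product, as a ⋆-homomorphism. -/
def singleStarHom {J : Type*} [DecidableEq J] {m : J → ℕ} (w : J) :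
    Matrix (Fin (m w)) (Fin (m w)) ℂ →⋆ₙₐ[ℂ] ∀ j, Matrix (Fin (m j)) (Fin (m j)) ℂ where
  toFun x := Pi.single (M := fun j => Matrix (Fin (m j)) (Fin (m j)) ℂ) w x
  map_smul' c x := by rw [Pi.single_smul]; rfl
  map_zero' := by simp
  map_add' x y := by simp [Pi.single_add]
  map_mul' x y := by simp [Pi.single_mul]
  map_star' x := by
    funext j
    by_cases hj : j = w
    · subst hj; simp
    · simp [hj]

/-- `X` is isomorphic, as a topological vector space, to a complemented subspace of `Y`. -/
def IsComplementedIn (X Y : Type*) [NormedAddCommGroup X] [NormedSpace ℂ X]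
    [NormedAddCommGroup Y] [NormedSpace ℂ Y] : Prop :=
  ∃ (i : X →L[ℂ] Y) (p : Y →L[ℂ] X), ∀ x, p (i x) = x

section System

variable {I : ℕ → Type*} [∀ k, Fintype (I k)] {n : ∀ k, I k → ℕ}
  (Φ : ∀ k, (∀ i : I k, Matrix (Fin (n k i)) (Fin (n k i)) ℂ) →⋆ₐ[ℂ]
    ∀ j : I (k + 1), Matrix (Fin (n (k + 1) j)) (Fin (n (k + 1) j)) ℂ)
  {B : Type*} [NonUnitalCStarAlgebra B] {T : AFSystem} {κ : ∀ k, T.Alg k →⋆ₙₐ[ℂ] B}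

/-- The algebras of a unital system starting with `ℂ` can be placed as block diagonal corners `R k` of
matrix summands `w k` of a system with the Fermion property, in such a way that the compressions to
these corners are compatible with the connecting maps of both systems, and that the ranges of the
`R (k + 1) j` reduce the image of the `k`-th corner. -/
theorem exists_corner_system [Unique (I 0)] (hn0 : ∀ i, n 0 i = 1)
    {μ : ∀ k, I (k + 1) → I k → ℕ}
    {W : ∀ k j, ∀ p : (Σ i, Fin (μ k j i)), Matrix (Fin (n (k + 1) j)) (Fin (n k p.1)) ℂ}
    (hW : ∀ k j, IsPresentedBy (fun x => Φ k x j) Sigma.fst (W k j))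
    (hinj : ∀ k, Function.Injective (κ k))
    (hκ : ∀ k x, κ (k + 1) (T.map k x) = κ k x) (hT : T.bratteli.FermionProperty) :
    ∃ (w : ℕ → Σ k, Fin (T.width k))
      (R : ∀ k i, Matrix (Fin (T.size (w k).1 (w k).2)) (Fin (n k i)) ℂ),
      StrictMono (fun k => (w k).1) ∧ (∀ k, IsOrthoIsometries (R k)) ∧
      (∀ k b b', κ (w k).1 b = κ (w (k + 1)).1 b' → ∀ j,
        (R (k + 1) j)ᴴ * b' (w (k + 1)).2 * R (k + 1) j
          = Φ k (fun i => (R k i)ᴴ * b (w k).2 * R k i) j) ∧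
      (∀ k b b' x, κ (w k).1 b = κ (w (k + 1)).1 b' → (∀ i, b (w k).2 * R k i = R k i * x i) →
        ∀ j, b' (w (k + 1)).2 * R (k + 1) j = R (k + 1) j * Φ k x j) := by
  obtain ⟨v, hv, hpath⟩ := hT
  let N : ℕ → ℕ := fun k => Fintype.card (Σ j, Σ i, Fin (μ k j i))
  -- the levels are chosen so sparse that there are enough paths between consecutive ones
  let t : ℕ → ℕ := fun k => Nat.rec 0 (fun k tk => tk + (N k + 1)) k
  have ht : ∀ k, t (k + 1) = t k + (N k + 1) := fun k => rfl
  let w : ℕ → Σ k, Fin (T.width k) := fun k => v (t k)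
  have hU : ∀ k, ∃ U : (Σ j, Σ i, Fin (μ k j i)) →
      Matrix (Fin (T.size (w (k + 1)).1 (w (k + 1)).2)) (Fin (T.size (w k).1 (w k).2)) ℂ,
      IsOrthoIsometries U ∧ ∀ a b b', κ (w k).1 b = κ (w (k + 1)).1 b' →
        b' (w (k + 1)).2 * U a = U a * b (w k).2 := fun k =>
    (AFSystem.hasIntertwiners_pow hinj hκ hv hpath (t k) (N k + 1)).exists_family
      ((Nat.lt_two_pow_self).le.trans (Nat.pow_le_pow_right two_pos (Nat.le_succ _)))
  choose U hU hUb using hU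
  let R : ∀ k i, Matrix (Fin (T.size (w k).1 (w k).2)) (Fin (n k i)) ℂ := fun k =>
    Nat.rec (motive := fun k => ∀ i, Matrix (Fin (T.size (w k).1 (w k).2)) (Fin (n k i)) ℂ)
      (fun i => Matrix.of fun r _ => if r = ⟨0, T.size_pos _ _⟩ then 1 else 0)
      (fun k Rk => transport (fun _ => Sigma.fst) (W k) (U k) Rk) k
  have hR : ∀ k, R (k + 1) = transport (fun _ => Sigma.fst) (W k) (U k) (R k) := fun k => rfl
  refine ⟨w, R, strictMono_nat_of_lt_succ fun k => hv ?_, ?_, ?_, ?_⟩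
  · rw [ht]; omega
  · intro k
    induction k with
    | zero =>
      refine ⟨fun i => ?_, fun i j hij => absurd (Subsingleton.elim i j) hij⟩
      ext a b
      have hab : a = b := by
        have := hn0 i
        apply Fin.ext
        omega
      subst hab
      simp [R, Matrix.mul_apply]
    | succ k ih =>
      rw [hR]
      exact transport_isOrthoIsometries (hU k) (hW k) ih
  · intro k b b' hb j
    rw [hR]
    exact transport_compression (hU k) (hW k) (fun a => hUb k a b b' hb) j
  · intro k b b' x hb hx j
    rw [hR]
    exact mul_transport (hW k) (fun a => hUb k a b b' hb) hx j

/-- A Banach space `X` that is the direct limit, up to equivalent norms, of a unital system starting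
with `ℂ` is complemented in every AF algebra with the Fermion property. The projection is the limit of
the compressions to the corners of `exists_corner_system`, and the embedding comes from
`exists_compatible_lifting`. -/
theorem isComplementedIn_of_unital_system [∀ k, DecidableEq (I k)] {X : Type*} [NormedAddCommGroup X] [NormedSpace ℂ X]
    [CompleteSpace X] [Unique (I 0)] (hn0 : ∀ i, n 0 i = 1) (hn : ∀ k i, 0 < n k i)
    (hΦ : ∀ k, Function.Injective (Φ k))
    (ι : ∀ k, (∀ i : I k, Matrix (Fin (n k i)) (Fin (n k i)) ℂ) →ₗ[ℂ] X)
    (hιΦ : ∀ k x, ι (k + 1) (Φ k x) = ι k x) {C : ℝ} (hC : ∀ k x, ‖ι k x‖ ≤ C * ‖x‖)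
    {D : ℝ} (hD : ∀ k x, ‖x‖ ≤ D * ‖ι k x‖) (hdense : Dense (⋃ k, Set.range (ι k)))
    (hT : T.bratteli.FermionProperty) (hB : T.IsDirectLimit B) : IsComplementedIn X B := by
  have hC' : ∃ C' : ℝ, 0 ≤ C' ∧ ∀ k x, ‖ι k x‖ ≤ C' * ‖x‖ :=
    ⟨|C|, abs_nonneg _, fun k x => (hC k x).trans
      (mul_le_mul_of_nonneg_right (le_abs_self _) (norm_nonneg _))⟩
  clear hC
  obtain ⟨C, hC0, hC⟩ := hC'
  obtain ⟨κ, hinj, hκ, hκd⟩ := hB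
  choose μ W hW using fun k j => exists_presentation (hn k)
    ((Pi.evalStarAlgHom ℂ (fun j => Matrix (Fin (n (k + 1) j)) (Fin (n (k + 1) j)) ℂ) j).comp (Φ k))
  replace hW : ∀ k j, IsPresentedBy (fun x => Φ k x j) Sigma.fst (W k j) := hW
  obtain ⟨w, R, hw, hR, hcomp, hint⟩ := exists_corner_system Φ hn0 hW hinj hκ hT
  choose E hE hE_norm using fun k => exists_expectation (hn k) (Φ k) (hΦ k) (hW k)
  have hmono : Monotone fun k => (w k).1 := hw.monotone
  -- compressions to the corners; compatible by `hcomp`, hence they define `P` on all of `B`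
  let p : ∀ k, T.Alg (w k).1 →ₗ[ℂ] ∀ i : I k, Matrix (Fin (n k i)) (Fin (n k i)) ℂ := fun k =>
    { toFun := fun b i => (R k i)ᴴ * b (w k).2 * R k i
      map_add' := fun x y => by funext i; simp [Matrix.mul_add, Matrix.add_mul]
      map_smul' := fun a x => by funext i; simp }
  have hp_norm : ∀ k b, ‖p k b‖ ≤ ‖κ (w k).1 b‖ := by
    intro k b
    rw [NonUnitalStarAlgHom.norm_map _ (hinj _)]
    refine (pi_norm_le_iff_of_nonneg (norm_nonneg _)).2 fun i => ?_
    exact (norm_compression_le ((hR k).1 i) _).trans (norm_le_pi_norm b (w k).2)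
  obtain ⟨P, hP⟩ := exists_extension (fun k => (κ (w k).1 : T.Alg (w k).1 →ₗ[ℂ] B))
    (fun k => ι k ∘ₗ p k) C
    (fun k b => (hC _ _).trans (mul_le_mul_of_nonneg_left (hp_norm k b) hC0))
    (by
      intro k b
      obtain ⟨b', hb'⟩ := AFSystem.exists_lift hκ (hmono (Nat.le_succ k)) b
      refine ⟨b', hb', ?_⟩
      have : p (k + 1) b' = Φ k (p k b) := funext fun j => hcomp k b b' hb'.symm j
      change ι (k + 1) (p (k + 1) b') = ι k (p k b)
      rw [this, hιΦ])
    (by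
      refine hκd.mono ?_
      rintro _ ⟨_, ⟨k, rfl⟩, b, rfl⟩
      obtain ⟨b', hb'⟩ := AFSystem.exists_lift hκ (hw.le_apply (x := k)) b
      exact Set.mem_iUnion.2 ⟨k, b', hb'⟩)
  -- the corner embeddings; they are compatible only after cutting down by `j (k + 1) 1`
  let j : ∀ k, (∀ i : I k, Matrix (Fin (n k i)) (Fin (n k i)) ℂ) →⋆ₙₐ[ℂ] B := fun k =>
    (κ (w k).1).comp ((singleStarHom (w k).2).comp (cornerEmbedding (R k) (hR k)))
  have hj_apply : ∀ k x, j k x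
      = κ (w k).1 (Pi.single (w k).2 (cornerEmbedding (R k) (hR k) x)) := fun k x => rfl
  have hj : ∀ k x, j k x * j (k + 1) 1 = j (k + 1) (Φ k x) := by
    intro k x
    obtain ⟨b', hb'⟩ := AFSystem.exists_lift hκ (hmono (Nat.le_succ k))
      (Pi.single (w k).2 (cornerEmbedding (R k) (hR k) x) : T.Alg (w k).1)
    have h := hint k _ b' x hb'.symm (fun i => by
      rw [Pi.single_eq_same]; exact cornerEmbedding_mul _ _ _ _)
    rw [hj_apply, hj_apply, hj_apply, ← hb', ← map_mul]
    congr 1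
    funext u
    by_cases hu : u = (w (k + 1)).2
    · subst hu
      rw [Pi.mul_apply, Pi.single_eq_same, Pi.single_eq_same]
      change _ * (∑ i, _) = ∑ i, _
      rw [Matrix.mul_sum]
      refine Finset.sum_congr rfl fun i _ => ?_
      rw [← h, Pi.one_apply, Matrix.mul_one, Matrix.mul_assoc]
    · rw [Pi.mul_apply, Pi.single_eq_of_ne hu, Pi.single_eq_of_ne hu, mul_zero]
  let M : ℕ → NonUnitalSubalgebra ℂ B := fun k =>
    NonUnitalAlgHom.range (κ (w k).1 : T.Alg (w k).1 →ₙₐ[ℂ] B)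
  have hM : Monotone M := by
    rintro k l hkl _ ⟨b, rfl⟩
    exact AFSystem.exists_lift hκ (hmono hkl) b
  obtain ⟨i, hiΦ, hi_norm, hi1, hiM⟩ := exists_compatible_lifting Φ E hE hE_norm j hj M hM
    (fun k x => ⟨_, rfl⟩)
  obtain ⟨F, hF⟩ := exists_extension ι i D (fun k x => (hi_norm k x).trans (hD k x))
    (fun k x => ⟨Φ k x, hιΦ k x, hiΦ k x⟩) hdense
  refine ⟨F, P, fun x => ?_⟩
  have hPF : Set.EqOn (fun x => P (F x)) id (⋃ k, Set.range (ι k)) := by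
    rintro _ ⟨_, ⟨k, rfl⟩, x, rfl⟩
    obtain ⟨b, hb⟩ := hiM k x
    replace hb : κ (w k).1 b = i k x := hb
    have h1 : κ (w k).1 (Pi.single (w k).2 (cornerEmbedding (R k) (hR k) 1) * b)
        = κ (w k).1 (Pi.single (w k).2 (cornerEmbedding (R k) (hR k) x)) := by
      rw [map_mul, hb]
      exact hi1 k x
    have h2 := congrFun (hinj _ h1) (w k).2
    rw [Pi.mul_apply, Pi.single_eq_same, Pi.single_eq_same] at h2
    -- the corner of `b` is `x`, so its compression is `x`
    have h3 : p k b = x := by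
      funext a
      have h4 : (R k a)ᴴ * cornerEmbedding (R k) (hR k) 1 = (R k a)ᴴ := by
        have := congrArg conjTranspose (cornerEmbedding_mul (R k) (hR k) 1 a)
        rwa [conjTranspose_mul, ← star_eq_conjTranspose (cornerEmbedding _ _ _), ← map_star,
          star_one, Pi.one_apply, Matrix.mul_one] at this
      change (R k a)ᴴ * b (w k).2 * R k a = x a
      rw [← h4, Matrix.mul_assoc _ _ (b _), h2, Matrix.mul_assoc, cornerEmbedding_mul,
        ← Matrix.mul_assoc, (hR k).1, Matrix.one_mul]
    change P (F (ι k x)) = ι k x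
    rw [hF, ← hb]
    exact (hP k b).trans (congrArg (ι k) h3)
  exact congrFun (Continuous.ext_on hdense (P.continuous.comp F.continuous) continuous_id hPF) x

end System

/-! ### Null sequences in an AF algebra -/

section NullSequences

variable {A : Type*} [NormedAddCommGroup A]

/-- The null sequence with prescribed first `k` entries and all other entries zero. -/
def nullSequence [NormedSpace ℂ A] (k : ℕ) : (Fin k → A) →ₗ[ℂ] C₀(ℕ, A) where
  toFun f :=
    { toFun := fun a => if h : a < k then f ⟨a, h⟩ else 0
      continuous_toFun := continuous_of_discreteTopology
      zero_at_infty' := by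
        rw [Filter.cocompact_eq_cofinite, Nat.cofinite_eq_atTop]
        refine tendsto_const_nhds.congr' ?_
        filter_upwards [Filter.eventually_ge_atTop k] with a ha
        rw [dif_neg (not_lt.2 ha)] }
  map_add' f g := by
    ext a
    simp only [ZeroAtInftyContinuousMap.coe_add, Pi.add_apply, ZeroAtInftyContinuousMap.coe_mk]
    split_ifs <;> simp
  map_smul' c f := by
    ext a
    simp only [ZeroAtInftyContinuousMap.coe_smul, Pi.smul_apply, ZeroAtInftyContinuousMap.coe_mk]
    split_ifs <;> simp

theorem nullSequence_apply [NormedSpace ℂ A] {k : ℕ} (f : Fin k → A) (a : ℕ) :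
    nullSequence k f a = if h : a < k then f ⟨a, h⟩ else 0 := rfl

theorem nullSequence_apply_of_lt [NormedSpace ℂ A] {k : ℕ} (f : Fin k → A) {a : ℕ} (h : a < k) :
    nullSequence k f a = f ⟨a, h⟩ := dif_pos h

theorem nullSequence_apply_of_le [NormedSpace ℂ A] {k : ℕ} (f : Fin k → A) {a : ℕ} (h : k ≤ a) :
    nullSequence k f a = 0 := dif_neg (not_lt.2 h)

theorem norm_zeroAtInfty_le {f : C₀(ℕ, A)} {C : ℝ} (hC : 0 ≤ C) (h : ∀ a, ‖f a‖ ≤ C) :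
    ‖f‖ ≤ C := by
  rw [← ZeroAtInftyContinuousMap.norm_toBCF_eq_norm]
  exact (BoundedContinuousFunction.norm_le hC).2 h

theorem norm_apply_le_zeroAtInfty (f : C₀(ℕ, A)) (a : ℕ) : ‖f a‖ ≤ ‖f‖ := by
  rw [← ZeroAtInftyContinuousMap.norm_toBCF_eq_norm]
  exact f.toBCF.norm_coe_le_norm a

theorem exists_norm_apply_lt (f : C₀(ℕ, A)) {ε : ℝ} (hε : 0 < ε) :
    ∃ N, ∀ a, N ≤ a → ‖f a‖ < ε := by
  have h := f.zero_at_infty'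
  rw [Filter.cocompact_eq_cofinite, Nat.cofinite_eq_atTop] at h
  exact Filter.eventually_atTop.1
    (h.norm.eventually_lt_const (by rw [norm_zero]; exact hε))

end NullSequences

namespace AFSystem

variable (S : AFSystem)

/-- The sizes of the matrix summands of the unitization of `A_k ⊕ ⋯ ⊕ A_k` (`k` copies). -/
def nullSize (k : ℕ) : Option (Fin k × Fin (S.width k)) → ℕ
  | none => 1
  | some p => S.size k p.2

/-- The unitization of `A_k ⊕ ⋯ ⊕ A_k` (`k` copies), as a direct sum of matrix algebras: the summand
`none` is the quotient `ℂ` of the unitization. These algebras form a unital direct system with limit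
the unitization of `C₀(ℕ, A)`. -/
abbrev NullAlg (k : ℕ) : Type :=
  ∀ o, Matrix (Fin (S.nullSize k o)) (Fin (S.nullSize k o)) ℂ

theorem nullSize_pos (k : ℕ) : ∀ o, 0 < S.nullSize k o
  | none => Nat.one_pos
  | some p => S.size_pos k p.2

variable {S} {k : ℕ}

namespace NullAlg

/-- The component of `x` in the `a`-th copy of `A_k`. -/
def coord (x : S.NullAlg k) (a : Fin k) : S.Alg k := fun i => x (some (a, i))

/-- The component of `x` in the summand `none`, of size `1`. -/
def block (x : S.NullAlg k) : Matrix (Fin 1) (Fin 1) ℂ := x none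

/-- The scalar component of `x`. -/
def scal (x : S.NullAlg k) : ℂ := x.block 0 0

/-- The element with given components in the copies of `A_k` and given scalar component. -/
def mk (y : Fin k → S.Alg k) (c : ℂ) : S.NullAlg k
  | none => (Matrix.of fun _ _ => c : Matrix (Fin 1) (Fin 1) ℂ)
  | some p => y p.1 p.2

@[simp] theorem coord_mk (y : Fin k → S.Alg k) (c : ℂ) (a : Fin k) : (mk y c).coord a = y a := rfl

@[simp] theorem scal_mk (y : Fin k → S.Alg k) (c : ℂ) : (mk y c).scal = c := rfl

theorem ext {x y : S.NullAlg k} (h : ∀ a, x.coord a = y.coord a) (h' : x.scal = y.scal) :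
    x = y := by
  funext o
  match o with
  | none =>
    change x.block = y.block
    ext a b
    rw [Subsingleton.elim a 0, Subsingleton.elim b 0]
    exact h'
  | some (a, i) => exact congrFun (h a) i

@[simp] theorem coord_add (x y : S.NullAlg k) (a) : (x + y).coord a = x.coord a + y.coord a := rfl
@[simp] theorem coord_mul (x y : S.NullAlg k) (a) : (x * y).coord a = x.coord a * y.coord a := rfl
@[simp] theorem coord_smul (c : ℂ) (x : S.NullAlg k) (a) : (c • x).coord a = c • x.coord a := rfl
@[simp] theorem coord_one (a) : (1 : S.NullAlg k).coord a = 1 := rfl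
@[simp] theorem coord_zero (a) : (0 : S.NullAlg k).coord a = 0 := rfl
@[simp] theorem coord_star (x : S.NullAlg k) (a) : (star x).coord a = star (x.coord a) := rfl
@[simp] theorem scal_add (x y : S.NullAlg k) : (x + y).scal = x.scal + y.scal := rfl
@[simp] theorem scal_smul (c : ℂ) (x : S.NullAlg k) : (c • x).scal = c * x.scal := rfl
@[simp] theorem scal_one : (1 : S.NullAlg k).scal = 1 :=
  Matrix.one_apply_eq (0 : Fin 1)
@[simp] theorem scal_zero : (0 : S.NullAlg k).scal = 0 := rfl
@[simp] theorem scal_star (x : S.NullAlg k) : (star x).scal = star x.scal := rfl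
@[simp] theorem scal_mul (x y : S.NullAlg k) : (x * y).scal = x.scal * y.scal := by
  change (x.block * y.block) 0 0 = _
  simp [Matrix.mul_apply, scal]

theorem norm_none (x : S.NullAlg k) : ‖x none‖ = ‖x.scal‖ := by
  have h : x.block = diagonal fun _ => x.scal := by
    ext a b
    rw [Subsingleton.elim a 0, Subsingleton.elim b 0]
    simp [scal]
  change ‖x.block‖ = _
  rw [h, l2_opNorm_diagonal, Pi.norm_def]
  simp

theorem norm_scal_le (x : S.NullAlg k) : ‖x.scal‖ ≤ ‖x‖ := by
  rw [← norm_none]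
  exact norm_le_pi_norm x none

theorem norm_coord_le (x : S.NullAlg k) (a : Fin k) : ‖x.coord a‖ ≤ ‖x‖ :=
  (pi_norm_le_iff_of_nonneg (norm_nonneg _)).2 fun i => norm_le_pi_norm x (some (a, i))

theorem norm_le {x : S.NullAlg k} {C : ℝ} (h : ∀ a, ‖x.coord a‖ ≤ C) (h' : ‖x.scal‖ ≤ C) :
    ‖x‖ ≤ C := by
  refine (pi_norm_le_iff_of_nonneg ((norm_nonneg _).trans h')).2 fun o => ?_
  match o with
  | none => rw [norm_none]; exact h'
  | some (a, i) => exact (norm_le_pi_norm (x.coord a) i).trans (h a)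

end NullAlg

theorem norm_one_le (S : AFSystem) (k : ℕ) : ‖(1 : S.Alg k)‖ ≤ 1 :=
  (pi_norm_le_iff_of_nonneg zero_le_one).2 fun _ => norm_le_one_of_isometry (by simp)

/-- The connecting maps for the algebras `NullAlg`: the unital extension of
`(x_0, …, x_{k-1}) ↦ (φ x_0, …, φ x_{k-1}, 0)`. -/
noncomputable def nullMap (S : AFSystem) (k : ℕ) : S.NullAlg k →⋆ₐ[ℂ] S.NullAlg (k + 1) where
  toFun x := NullAlg.mk (fun a => if h : a.1 < k then
    S.map k (x.coord ⟨a, h⟩) + x.scal • (1 - S.map k 1) else x.scal • 1) x.scal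
  map_one' := by
    refine NullAlg.ext (fun a => ?_) (by simp)
    simp
  map_mul' x y := by
    refine NullAlg.ext (fun a => ?_) (by simp)
    simp only [NullAlg.coord_mk, NullAlg.coord_mul, NullAlg.scal_mul]
    split_ifs with h
    · have h1 : ∀ z, S.map k z * (1 - S.map k 1) = 0 := fun z => by
        rw [mul_sub, ← map_mul, mul_one, mul_one, sub_self]
      have h2 : ∀ z, (1 - S.map k 1) * S.map k z = 0 := fun z => by
        rw [sub_mul, ← map_mul, one_mul, one_mul, sub_self]
      have h3 : (1 - S.map k 1) * (1 - S.map k 1) = 1 - S.map k 1 := by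
        rw [mul_sub, h2, sub_zero, mul_one]
      rw [add_mul, mul_add, mul_add, smul_mul_assoc, smul_mul_assoc, mul_smul_comm, mul_smul_comm,
        h1, h2, h3, map_mul, smul_zero, smul_zero, add_zero, zero_add, smul_smul]
    · rw [smul_mul_assoc, one_mul, smul_smul]
  map_zero' := by
    refine NullAlg.ext (fun a => ?_) rfl
    simp
  map_add' x y := by
    refine NullAlg.ext (fun a => ?_) rfl
    simp only [NullAlg.coord_mk, NullAlg.coord_add, NullAlg.scal_add]
    split_ifs with h
    · rw [map_add, add_smul]; abel
    · rw [add_smul]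
  commutes' r := by
    rw [Algebra.algebraMap_eq_smul_one, Algebra.algebraMap_eq_smul_one]
    refine NullAlg.ext (fun a => ?_) rfl
    simp only [NullAlg.coord_mk, NullAlg.coord_smul, NullAlg.scal_smul, NullAlg.coord_one,
      NullAlg.scal_one, mul_one]
    split_ifs with h
    · rw [map_smul, ← smul_add, add_sub_cancel]
    · rfl
  map_star' x := by
    refine NullAlg.ext (fun a => ?_) rfl
    simp only [NullAlg.coord_mk, NullAlg.coord_star, NullAlg.scal_star]
    split_ifs with h
    · rw [star_add, star_smul, star_sub, star_one, ← map_star, ← map_star, star_one]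
    · rw [star_smul, star_one]

theorem scal_nullMap (x : S.NullAlg k) : (S.nullMap k x).scal = x.scal := rfl

theorem coord_nullMap (x : S.NullAlg k) (a : Fin (k + 1)) :
    (S.nullMap k x).coord a = if h : a.1 < k then
      S.map k (x.coord ⟨a, h⟩) + x.scal • (1 - S.map k 1) else x.scal • 1 := rfl

variable {A : Type*} [NonUnitalCStarAlgebra A] (ι : ∀ k, S.Alg k →⋆ₙₐ[ℂ] A)

/-- The maps of the algebras `NullAlg` into `C₀(ℕ, A) × ℂ`, the splitting of the unitization as a
Banach space. -/
noncomputable def nullEmbedding (k : ℕ) : S.NullAlg k →ₗ[ℂ] C₀(ℕ, A) × ℂ where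
  toFun x := (nullSequence k fun a => ι k (x.coord a - x.scal • 1), x.scal)
  map_add' x y := by
    refine Prod.ext ?_ rfl
    change _ = nullSequence k _ + nullSequence k _
    rw [← map_add]
    refine congrArg (nullSequence k) (funext fun a => ?_)
    rw [Pi.add_apply, ← map_add]
    congr 1
    simp only [NullAlg.coord_add, NullAlg.scal_add, add_smul]
    abel
  map_smul' c x := by
    refine Prod.ext ?_ rfl
    change _ = c • nullSequence k _
    rw [← map_smul]
    refine congrArg (nullSequence k) (funext fun a => ?_)
    rw [Pi.smul_apply, ← map_smul]
    congr 1
    simp [smul_sub, smul_smul]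

theorem nullEmbedding_apply (x : S.NullAlg k) :
    nullEmbedding ι k x = (nullSequence k fun a => ι k (x.coord a - x.scal • 1), x.scal) := rfl

variable {ι}

/-- The splitting `(y, c) ↦ (y - c 1, c)` of the unitization is compatible with the connecting maps,
although the units of the algebras `A_k` are not. -/
theorem nullEmbedding_nullMap (hι : ∀ k x, ι (k + 1) (S.map k x) = ι k x) (k : ℕ)
    (x : S.NullAlg k) : nullEmbedding ι (k + 1) (S.nullMap k x) = nullEmbedding ι k x := by
  rw [nullEmbedding_apply, nullEmbedding_apply, scal_nullMap]
  refine Prod.ext ?_ rfl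
  ext a
  change nullSequence _ _ a = nullSequence _ _ a
  rcases lt_trichotomy a k with h | h | h
  · rw [nullSequence_apply_of_lt _ h, nullSequence_apply_of_lt _ (Nat.lt_succ_of_lt h),
      coord_nullMap, dif_pos h, ← hι k]
    refine congrArg (ι (k + 1)) ?_
    rw [map_sub, map_smul, smul_sub]
    abel
  · rw [nullSequence_apply_of_le _ h.ge, nullSequence_apply_of_lt _ (by omega), coord_nullMap,
      dif_neg (by simp [h]), sub_self, map_zero]
  · rw [nullSequence_apply_of_le _ h.le, nullSequence_apply_of_le _ h]

theorem norm_nullEmbedding_le (k : ℕ) (x : S.NullAlg k) : ‖nullEmbedding ι k x‖ ≤ 2 * ‖x‖ := by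
  have hx := norm_nonneg x
  have h1 := x.norm_scal_le
  rw [nullEmbedding_apply, Prod.norm_def]
  refine max_le (norm_zeroAtInfty_le (by positivity) fun a => ?_) (by linarith)
  rw [nullSequence_apply]
  split_ifs with h
  · refine (NonUnitalStarAlgHom.norm_apply_le _ _).trans ((norm_sub_le _ _).trans ?_)
    have h2 := x.norm_coord_le ⟨a, h⟩
    have h3 : ‖x.scal • (1 : S.Alg k)‖ ≤ ‖x.scal‖ * 1 := by
      rw [norm_smul]
      exact mul_le_mul_of_nonneg_left (S.norm_one_le k) (norm_nonneg _)
    linarith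
  · rw [norm_zero]; positivity

theorem norm_le_nullEmbedding (hinj : ∀ k, Function.Injective (ι k)) (k : ℕ) (x : S.NullAlg k) :
    ‖x‖ ≤ 2 * ‖nullEmbedding ι k x‖ := by
  have h0 := norm_nonneg (nullEmbedding ι k x)
  have h1 : ‖x.scal‖ ≤ ‖nullEmbedding ι k x‖ := norm_snd_le (nullEmbedding ι k x)
  refine NullAlg.norm_le (fun a => ?_) (by linarith)
  have h2 : ‖x.coord a - x.scal • 1‖ ≤ ‖nullEmbedding ι k x‖ := by
    rw [← NonUnitalStarAlgHom.norm_map (ι k) (hinj k)]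
    have := norm_apply_le_zeroAtInfty (nullEmbedding ι k x).1 a
    rw [nullEmbedding_apply] at this
    change ‖nullSequence k _ (a : ℕ)‖ ≤ _ at this
    rw [nullSequence_apply_of_lt _ a.2] at this
    exact this.trans (norm_fst_le (nullEmbedding ι k x))
  have h3 : ‖x.scal • (1 : S.Alg k)‖ ≤ ‖x.scal‖ * 1 := by
    rw [norm_smul]
    exact mul_le_mul_of_nonneg_left (S.norm_one_le k) (norm_nonneg _)
  have h4 := norm_add_le (x.coord a - x.scal • 1) (x.scal • 1)
  rw [sub_add_cancel] at h4
  linarith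

theorem dense_nullEmbedding (hι : ∀ k x, ι (k + 1) (S.map k x) = ι k x)
    (hd : Dense (⋃ k, Set.range (ι k))) : Dense (⋃ k, Set.range (nullEmbedding ι k)) := by
  rintro ⟨f, c⟩
  refine Metric.mem_closure_iff.2 fun ε hε => ?_
  obtain ⟨N, hN⟩ := exists_norm_apply_lt f (half_pos hε)
  have happ : ∀ a, ∃ l y, ‖f a - ι l y‖ < ε / 2 := by
    intro a
    obtain ⟨_, ⟨_, ⟨l, rfl⟩, y, rfl⟩, h⟩ := Metric.mem_closure_iff.1 (hd (f a)) _ (half_pos hε)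
    exact ⟨l, y, by rwa [← dist_eq_norm]⟩
  choose l y hy using happ
  let k := N + ∑ a ∈ Finset.range N, l a
  have hl : ∀ a, a < N → l a ≤ k := fun a ha =>
    (Finset.single_le_sum (fun _ _ => Nat.zero_le _) (Finset.mem_range.2 ha)).trans
      (Nat.le_add_left _ _)
  have hlift : ∀ a, ∃ z : S.Alg k, a < N → ι k z = ι (l a) (y a) := by
    intro a
    by_cases ha : a < N
    · obtain ⟨z, hz⟩ := exists_lift hι (hl a ha) (y a)
      exact ⟨z, fun _ => hz⟩
    · exact ⟨0, fun h => absurd h ha⟩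
  choose z hz using hlift
  let x : S.NullAlg k := NullAlg.mk (fun a => (if a.1 < N then z a else 0) + c • 1) c
  refine ⟨_, Set.mem_iUnion.2 ⟨k, x, rfl⟩, ?_⟩
  rw [dist_eq_norm, nullEmbedding_apply, Prod.norm_def]
  refine max_lt ?_ (by simpa [x] using hε)
  refine lt_of_le_of_lt (norm_zeroAtInfty_le (half_pos hε).le fun a => ?_) (half_lt_self hε)
  change ‖f a - nullSequence k (fun a => ι k (x.coord a - x.scal • 1)) a‖ ≤ _
  rcases lt_or_ge a N with ha | ha
  · rw [nullSequence_apply_of_lt _ (ha.trans_le (Nat.le_add_right _ _))]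
    simp only [x, NullAlg.coord_mk, NullAlg.scal_mk, add_sub_cancel_right, if_pos ha, hz a ha]
    exact (hy a).le
  · have h0 : nullSequence k (fun a => ι k (x.coord a - x.scal • 1)) a = 0 := by
      rw [nullSequence_apply]
      split_ifs with h
      · simp [x, not_lt.2 ha]
      · rfl
    rw [h0, sub_zero]
    exact (hN a ha).le

/-- The null sequences in any AF algebra form, together with a copy of `ℂ`, a complemented subspace of
every AF algebra with the Fermion property. -/
theorem isComplementedIn_zeroAtInfty {T : AFSystem} {B : Type*} [NonUnitalCStarAlgebra B]
    (hA : S.IsDirectLimit A) (hB : T.IsDirectLimit B) (hT : T.bratteli.FermionProperty) :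
    IsComplementedIn (C₀(ℕ, A) × ℂ) B := by
  obtain ⟨ι, hinj, hι, hd⟩ := hA
  have hD := norm_le_nullEmbedding hinj
  refine isComplementedIn_of_unital_system (n := S.nullSize) S.nullMap ?_ S.nullSize_pos ?_
    (nullEmbedding ι) (nullEmbedding_nullMap hι) norm_nullEmbedding_le hD
    (dense_nullEmbedding hι hd) hT hB
  · rintro (_ | ⟨a, -⟩)
    · rfl
    · exact a.elim0
  · intro k x y hxy
    have h := hD k (x - y)
    rw [map_sub, ← nullEmbedding_nullMap hι k x, hxy, nullEmbedding_nullMap hι, sub_self,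
      norm_zero, mul_zero] at h
    exact sub_eq_zero.1 (norm_le_zero_iff.1 h)

end AFSystem

/-! ### The decomposition method -/

section Decomposition

variable {X Y Z : Type*} [NormedAddCommGroup X] [NormedSpace ℂ X]
  [NormedAddCommGroup Y] [NormedSpace ℂ Y] [NormedAddCommGroup Z] [NormedSpace ℂ Z]

theorem IsComplementedIn.trans (h₁ : IsComplementedIn X Y) (h₂ : IsComplementedIn Y Z) :
    IsComplementedIn X Z := by
  obtain ⟨i, p, hpi⟩ := h₁
  obtain ⟨j, q, hqj⟩ := h₂
  exact ⟨j.comp i, p.comp q, fun x => by simp [hqj, hpi]⟩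

theorem isComplementedIn_prod_left : IsComplementedIn X (X × Y) :=
  ⟨.inl ℂ X Y, .fst ℂ X Y, fun _ => rfl⟩

theorem IsComplementedIn.exists_equiv_prod (h : IsComplementedIn X Y) :
    ∃ W : Submodule ℂ Y, Nonempty (Y ≃L[ℂ] X × W) := by
  obtain ⟨i, p, hpi⟩ := h
  exact ⟨_, ⟨ContinuousLinearEquiv.equivOfRightInverse p i hpi⟩⟩

/-- Prepending a first term to a null sequence. -/
def consZeroAtInfty (q : X × C₀(ℕ, X)) : C₀(ℕ, X) where
  toFun a := Nat.casesOn a q.1 q.2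
  continuous_toFun := continuous_of_discreteTopology
  zero_at_infty' := by
    have h := q.2.zero_at_infty'
    rw [Filter.cocompact_eq_cofinite, Nat.cofinite_eq_atTop] at h ⊢
    exact (Filter.tendsto_add_atTop_iff_nat 1).1 h

/-- Dropping the first term of a null sequence. -/
def tailZeroAtInfty (f : C₀(ℕ, X)) : C₀(ℕ, X) where
  toFun a := f (a + 1)
  continuous_toFun := continuous_of_discreteTopology
  zero_at_infty' := by
    have h := f.zero_at_infty'
    rw [Filter.cocompact_eq_cofinite, Nat.cofinite_eq_atTop] at h ⊢
    exact (Filter.tendsto_add_atTop_iff_nat 1).2 h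

/-- A null sequence is its first term together with the sequence of the remaining terms. -/
noncomputable def zeroAtInftyEquivProd (X : Type*) [NormedAddCommGroup X] [NormedSpace ℂ X] :
    C₀(ℕ, X) ≃L[ℂ] X × C₀(ℕ, X) :=
  LinearEquiv.toContinuousLinearEquivOfBounds
    { toFun := fun f => (f 0, tailZeroAtInfty f)
      invFun := consZeroAtInfty
      map_add' := fun _ _ => rfl
      map_smul' := fun _ _ => rfl
      left_inv := fun f => by
        ext a
        cases a <;> rfl
      right_inv := fun _ => rfl } 1 1
    (fun f => by
      rw [one_mul]
      exact max_le (norm_apply_le_zeroAtInfty f 0)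
        (norm_zeroAtInfty_le (norm_nonneg _) fun a => norm_apply_le_zeroAtInfty f (a + 1)))
    (fun q => by
      rw [one_mul]
      refine norm_zeroAtInfty_le (norm_nonneg _) fun a => ?_
      cases a with
      | zero => exact norm_fst_le q
      | succ a => exact (norm_apply_le_zeroAtInfty q.2 a).trans (norm_snd_le q))

theorem isComplementedIn_zeroAtInfty_self : IsComplementedIn X C₀(ℕ, X) :=
  ⟨(zeroAtInftyEquivProd X).symm.toContinuousLinearMap.comp (.inl ℂ _ _),
    (ContinuousLinearMap.fst ℂ _ _).comp (zeroAtInftyEquivProd X).toContinuousLinearMap,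
    fun x => by simp⟩

/-- A space containing its null sequences as a complemented subspace is isomorphic to its square. -/
theorem nonempty_equiv_prod_self (h : IsComplementedIn C₀(ℕ, X) X) :
    Nonempty (X ≃L[ℂ] X × X) := by
  obtain ⟨W, ⟨e⟩⟩ := h.exists_equiv_prod
  -- `X ≃ C₀ × W ≃ (X × C₀) × W ≃ X × (C₀ × W) ≃ X × X`
  exact ⟨e.trans <| ((zeroAtInftyEquivProd X).prodCongr (.refl ℂ W)).trans <|
    (ContinuousLinearEquiv.prodAssoc ℂ X C₀(ℕ, X) W).trans <|
      (ContinuousLinearEquiv.refl ℂ X).prodCongr e.symm⟩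

theorem IsComplementedIn.nonempty_equiv_prod (h : IsComplementedIn X Y)
    (hX : Nonempty (X ≃L[ℂ] X × X)) : Nonempty (Y ≃L[ℂ] X × Y) := by
  obtain ⟨W, ⟨e⟩⟩ := h.exists_equiv_prod
  obtain ⟨d⟩ := hX
  -- `Y ≃ X × W ≃ (X × X) × W ≃ X × (X × W) ≃ X × Y`
  exact ⟨e.trans <| (d.prodCongr (.refl ℂ W)).trans <|
    (ContinuousLinearEquiv.prodAssoc ℂ X X W).trans <|
      (ContinuousLinearEquiv.refl ℂ X).prodCongr e.symm⟩

/-- Pełczyński's decomposition method. -/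
theorem nonempty_equiv_of_isComplementedIn (hXY : IsComplementedIn X Y)
    (hYX : IsComplementedIn Y X) (hX : Nonempty (X ≃L[ℂ] X × X))
    (hY : Nonempty (Y ≃L[ℂ] Y × Y)) : Nonempty (X ≃L[ℂ] Y) := by
  obtain ⟨e⟩ := hYX.nonempty_equiv_prod hY
  obtain ⟨d⟩ := hXY.nonempty_equiv_prod hX
  exact ⟨e.trans ((ContinuousLinearEquiv.prodComm ℂ Y X).trans d.symm)⟩

end Decomposition

theorem theorem1p3 {A : Type*} {B : Type*} [NonUnitalCStarAlgebra A] [NonUnitalCStarAlgebra B]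
    (S T : AFSystem) (hA : S.IsDirectLimit A) (hB : T.IsDirectLimit B)
    (hS : S.bratteli.FermionProperty) (hT : T.bratteli.FermionProperty) :
    Nonempty (A ≃L[ℂ] B) := by
  have hAA : IsComplementedIn C₀(ℕ, A) A :=
    isComplementedIn_prod_left.trans (AFSystem.isComplementedIn_zeroAtInfty hA hA hS)
  have hBB : IsComplementedIn C₀(ℕ, B) B :=
    isComplementedIn_prod_left.trans (AFSystem.isComplementedIn_zeroAtInfty hB hB hT)
  have hAB : IsComplementedIn A B := isComplementedIn_zeroAtInfty_self.trans
    (isComplementedIn_prod_left.trans (AFSystem.isComplementedIn_zeroAtInfty hA hB hT))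
  have hBA : IsComplementedIn B A := isComplementedIn_zeroAtInfty_self.trans
    (isComplementedIn_prod_left.trans (AFSystem.isComplementedIn_zeroAtInfty hB hA hS))
  exact nonempty_equiv_of_isComplementedIn hAB hBA (nonempty_equiv_prod_self hAA)
    (nonempty_equiv_prod_self hBB)
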